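/- Let $N\ge 1$, let $\Omega\subset\mathbb R^N$ be a bounded domain satisfying the exterior sphere condition: for every $y\in\partial\Omega$ there are $z\in\mathbb R^N$ and $\delta>0$ with $B_\delta(z)\subset\mathbb R^N\setminus\Omega$ and $y\in\partial B_\delta(z)$. Let $T>0$, $2\le p<\infty$, $\alpha=\frac{p-2}{p+N}$, $\beta=\frac{N+2}{p+N}$, $\Omega_T=\Omega\times(0,T)$. For $\varepsilon>0$ put $$S_\varepsilon=\{x\in\mathbb R^N\setminus\Omega:\ \mathrm{dist}(x,\partial\Omega)\le\varepsilon\},\qquad \Gamma_p^\varepsilon=\big(S_\varepsilon\times(-\tfrac{\varepsilon^2}{2},T]\big)\cup\big(\Omega\times(-\tfrac{\varepsilon^2}{2},0]\big).$$ Let $I\subset(0,\infty)$ be a set of step sizes with $0\in\overline I$ (for example $I=(0,\infty)$ or $I=(0,\varepsilon_1)$). Let $\psi:\mathbb R^{N+1}\to\mathbb R$ and $F:\bigcup_{\varepsilon\in I}\Gamma_p^\varepsilon\to\mathbb R$ be bounded functions such that, for some constants $C_1,C_2$, $$|F(x,t)-F(y,s)|\le C_1\big(|x-y|+|t-s|^{1/2}\big)\quad\text{for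 }(x,t),(y,s)\in\Gamma_p^\varepsilon,\ \varepsilon\in I,$$ $$|\psi(x,t)-\psi(y,s)|\le C_2\big(|x-y|+|t-s|^{1/2}\big)\quad\text{for }(x,t),(y,s)\in\mathbb R^{N+1},$$ and $\psi\le F$ on $\Gamma_p^\varepsilon$ for $\varepsilon\in I$. For each $\varepsilon\in I$ let $u^\varepsilon:(\Omega\times(0,T])\cup\Gamma_p^\varepsilon\to\mathbb R$ be a bounded Borel function with $u^\varepsilon=F$ on $\Gamma_p^\varepsilon$ and, for all $(x,t)\in\Omega\times(0,T]$, $$u^\varepsilon(x,t)=\max\Big\{\psi(x,t),\ \tfrac{\alpha}{2}\Big(\sup_{y\in B_\varepsilon(x)}u^\varepsilon(y,t-\tfrac{\varepsilon^2}{2})+\inf_{y\in B_\varepsilon(x)}u^\varepsilon(y,t-\tfrac{\varepsilon^2}{2})\Big)+\beta\,\frac{1}{|B_\varepsilon(x)|}\int_{B_\varepsilon(x)}u^\varepsilon(y,t-\tfrac{\varepsilon^2}{2})\,dy\Big\}.$$ Then: 1. there is $C>0$ with $|u^\varepsilon(x,t)|<C$ for all $\varepsilon\in I$ and $(x,t)\in\overline{\Omega_T}$;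 2. for every $\eta>0$ there are $r_0>0$ and $\varepsilon_0>0$ such that $|u^\varepsilon(x,t)-u^\varepsilon(y,s)|<\eta$ for all $\varepsilon\in I$ with $\varepsilon<\varepsilon_0$ and all $(x,t),(y,s)\in\overline{\Omega_T}$ with $|x-y|+|t-s|<r_0$; 3. consequently, every sequence $\varepsilon_j\in I$ with $\varepsilon_j\to0$ has a subsequence along which $u^{\varepsilon_j}$ converges uniformly on $\overline{\Omega_T}$ to a uniformly continuous function $u:\overline{\Omega_T}\to\mathbb R$. -/

import Mathlib

namespace TugOfWar

open MeasureTheory Set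

/-- The parabolic cylinder `Ω_T = Ω × (0, T)`. -/
def cylinder {N : ℕ} (Ω : Set (EuclideanSpace ℝ (Fin N))) (T : ℝ) :
    Set (EuclideanSpace ℝ (Fin N) × ℝ) :=
  Ω ×ˢ Ioo 0 T

/-- The outer `ε`-boundary strip `S_ε = {x ∉ Ω : dist (x, ∂Ω) ≤ ε}`. -/
def spaceStrip {N : ℕ} (Ω : Set (EuclideanSpace ℝ (Fin N))) (ε : ℝ) :
    Set (EuclideanSpace ℝ (Fin N)) :=
  {x | x ∉ Ω ∧ Metric.infDist x (frontier Ω) ≤ ε}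

/-- The parabolic boundary strip
`Γ_p^ε = (S_ε × (-ε²/2, T]) ∪ (Ω × (-ε²/2, 0])`. -/
def parabolicStrip {N : ℕ} (Ω : Set (EuclideanSpace ℝ (Fin N))) (T ε : ℝ) :
    Set (EuclideanSpace ℝ (Fin N) × ℝ) :=
  (spaceStrip Ω ε ×ˢ Ioc (-(ε ^ 2 / 2)) T) ∪ (Ω ×ˢ Ioc (-(ε ^ 2 / 2)) 0)

/-- The exterior sphere condition; the radius may depend on the boundary point. -/
def ExteriorSphereCondition {N : ℕ} (Ω : Set (EuclideanSpace ℝ (Fin N))) : Prop :=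
  ∀ y ∈ frontier Ω, ∃ z : EuclideanSpace ℝ (Fin N), ∃ δ : ℝ,
    0 < δ ∧ Metric.ball z δ ⊆ Ωᶜ ∧ y ∈ frontier (Metric.ball z δ)

/-- The weight `α = (p - 2) / (p + N)` of the tug-of-war step. -/
noncomputable def weightTug (N : ℕ) (p : ℝ) : ℝ := (p - 2) / (p + N)

/-- The weight `β = (N + 2) / (p + N)` of the random step. -/
noncomputable def weightNoise (N : ℕ) (p : ℝ) : ℝ := (N + 2) / (p + N)

/-- `(α/2) (sup_{B_ε(x)} v(·, s) + inf_{B_ε(x)} v(·, s)) + β ⨍_{B_ε(x)} v(y, s) dy`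
at the earlier time `s = t - ε²/2`. -/
noncomputable def gameAverage {N : ℕ} (p ε : ℝ) (v : EuclideanSpace ℝ (Fin N) × ℝ → ℝ)
    (x : EuclideanSpace ℝ (Fin N)) (t : ℝ) : ℝ :=
  weightTug N p / 2 *
      (sSup ((fun y => v (y, t - ε ^ 2 / 2)) '' Metric.ball x ε) +
        sInf ((fun y => v (y, t - ε ^ 2 / 2)) '' Metric.ball x ε)) +
    weightNoise N p * ⨍ y in Metric.ball x ε, v (y, t - ε ^ 2 / 2)

/-- `v` is a bounded Borel solution of the dynamic programming principle with step `ε`,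
obstacle `ψ` and boundary data `F`. Only the values of `v` on
`(Ω × (0, T]) ∪ Γ_p^ε` matter. The equation is imposed up to and including the final time,
so that it determines `v` on the whole closure of `Ω_T`. -/
structure IsDPPSolution {N : ℕ} (Ω : Set (EuclideanSpace ℝ (Fin N))) (T p ε : ℝ)
    (ψ F v : EuclideanSpace ℝ (Fin N) × ℝ → ℝ) : Prop where
  borel : Measurable (((Ω ×ˢ Ioc 0 T) ∪ parabolicStrip Ω T ε).domRestrict v)
  bounded : ∃ M : ℝ, ∀ z ∈ (Ω ×ˢ Ioc 0 T) ∪ parabolicStrip Ω T ε, |v z| ≤ M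
  dpp : ∀ x ∈ Ω, ∀ t ∈ Ioc 0 T, v (x, t) = max (ψ (x, t)) (gameAverage p ε v x t)
  boundary : ∀ z ∈ parabolicStrip Ω T ε, v z = F z

end TugOfWar

/-! The value at time `t` depends only on values at `t - ε²/2`, so each estimate is an induction
over time steps. One step of the game is a monotone average that commutes with affine maps of either
sign and is nonexpansive in the sup norm. Monotonicity gives comparison with explicit barriers;
constant barriers already give the uniform bound.

Boundary continuity rests on `ballAverage_gaussian_ge`: averaging `exp (-lam ‖v‖²)` changes it by a
relative amount of at least `-lam ε² + lam² m ‖v‖² ε²`, with `m` the moment constant. Away from the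
centre a large `lam` turns this into a gain of order `ε²`. At a lateral point the Gaussian is
centred inside the exterior ball, and the gain pays for the time term of the barrier. At an initial
point it is centred at that point, and a term linear in time pays for the loss. The upper barrier
stays above the obstacle because `ψ ≤ F` at the boundary point.

Inside, `GameFamily.exists_modulus` compares a solution with its own translate by a fixed space-time
vector. If either point is near the parabolic boundary, boundary continuity (uniform by compactness)
bounds the difference. Otherwise both points obey the equation, the obstacle changes by its own
modulus, and nonexpansiveness carries the bound over from the previous time level without loss.
Convergence then follows from an Arzelà–Ascoli argument that only needs asymptotic equicontinuity.
-/

namespace TugOfWar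

open MeasureTheory Set

/-! ### The one-step average: monotone, affine, nonexpansive -/

section BallAverage

variable {N : ℕ}

/-- The tug-of-war average over the centred ball of radius `ε`. -/
noncomputable def ballAverage (p ε : ℝ) (f : EuclideanSpace ℝ (Fin N) → ℝ) : ℝ :=
  weightTug N p / 2 * (sSup (f '' Metric.ball 0 ε) + sInf (f '' Metric.ball 0 ε)) +
    weightNoise N p * ⨍ h in Metric.ball 0 ε, f h

/-- The conditions on `f` under which `ballAverage p ε f` has its intended meaning. -/
structure AverageableOn (ε : ℝ) (f : EuclideanSpace ℝ (Fin N) → ℝ) : Prop where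
  above : BddAbove (f '' Metric.ball 0 ε)
  below : BddBelow (f '' Metric.ball 0 ε)
  integrable : IntegrableOn f (Metric.ball 0 ε)

theorem weightTug_nonneg {p : ℝ} (hp : 2 ≤ p) : 0 ≤ weightTug N p := by
  unfold weightTug
  apply div_nonneg <;> linarith [(Nat.cast_nonneg N : (0 : ℝ) ≤ N)]

theorem weightNoise_pos {p : ℝ} (hp : 2 ≤ p) : 0 < weightNoise N p := by
  unfold weightNoise
  apply div_pos <;> linarith [(Nat.cast_nonneg N : (0 : ℝ) ≤ N)]

theorem weightTug_add_weightNoise {p : ℝ} (hp : 2 ≤ p) :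
    weightTug N p + weightNoise N p = 1 := by
  have : (0 : ℝ) < p + N := by linarith [(Nat.cast_nonneg N : (0 : ℝ) ≤ N)]
  unfold weightTug weightNoise
  field_simp
  ring

theorem measureReal_ball_pos {ε : ℝ} (hε : 0 < ε) (x : EuclideanSpace ℝ (Fin N)) :
    0 < volume.real (Metric.ball x ε) :=
  ENNReal.toReal_pos (Metric.measure_ball_pos _ _ hε).ne' measure_ball_lt_top.ne

theorem image_ball_nonempty {ε : ℝ} (hε : 0 < ε) (f : EuclideanSpace ℝ (Fin N) → ℝ) :
    (f '' Metric.ball 0 ε).Nonempty :=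
  (Metric.nonempty_ball.2 hε).image f

theorem setIntegral_ball_eq_centred (x : EuclideanSpace ℝ (Fin N)) (ε : ℝ)
    (f : EuclideanSpace ℝ (Fin N) → ℝ) :
    ∫ y in Metric.ball x ε, f y = ∫ h in Metric.ball 0 ε, f (x + h) := by
  have h := (measurePreserving_add_left (volume : Measure (EuclideanSpace ℝ (Fin N))) x)
    |>.setIntegral_preimage_emb (measurableEmbedding_addLeft x) f (Metric.ball x ε)
  rw [← h]
  congr 2
  ext y
  simp

theorem image_ball_eq_centred (x : EuclideanSpace ℝ (Fin N)) (ε : ℝ)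
    (f : EuclideanSpace ℝ (Fin N) → ℝ) :
    f '' Metric.ball x ε = (fun h => f (x + h)) '' Metric.ball 0 ε := by
  ext c
  constructor
  · rintro ⟨y, hy, rfl⟩
    exact ⟨y - x, by simpa [dist_eq_norm] using hy, by simp⟩
  · rintro ⟨h, hh, rfl⟩
    exact ⟨x + h, by simpa [dist_eq_norm] using hh, rfl⟩

theorem gameAverage_eq_ballAverage (p ε : ℝ) (v : EuclideanSpace ℝ (Fin N) × ℝ → ℝ)
    (x : EuclideanSpace ℝ (Fin N)) (t : ℝ) :
    gameAverage p ε v x t = ballAverage p ε (fun h => v (x + h, t - ε ^ 2 / 2)) := by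
  have hvol : volume.real (Metric.ball x ε) =
      volume.real (Metric.ball (0 : EuclideanSpace ℝ (Fin N)) ε) := by
    rw [measureReal_def, measureReal_def, Measure.addHaar_ball_center]
  rw [gameAverage, ballAverage, setAverage_eq, setAverage_eq,
    setIntegral_ball_eq_centred x ε (fun y => v (y, t - ε ^ 2 / 2)),
    image_ball_eq_centred x ε (fun y => v (y, t - ε ^ 2 / 2)), hvol]

theorem _root_.Continuous.averageableOn {f : EuclideanSpace ℝ (Fin N) → ℝ} (hf : Continuous f)
    (ε : ℝ) : AverageableOn ε f where
  above := ((isCompact_closedBall 0 ε).bddAbove_image hf.continuousOn).mono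
    (image_mono Metric.ball_subset_closedBall)
  below := ((isCompact_closedBall 0 ε).bddBelow_image hf.continuousOn).mono
    (image_mono Metric.ball_subset_closedBall)
  integrable := (hf.continuousOn.integrableOn_compact (isCompact_closedBall 0 ε)).mono_set
    Metric.ball_subset_closedBall

theorem ballAverage_mono {p ε : ℝ} (hp : 2 ≤ p) (hε : 0 < ε)
    {f g : EuclideanSpace ℝ (Fin N) → ℝ} (hf : AverageableOn ε f) (hg : AverageableOn ε g)
    (h : ∀ y ∈ Metric.ball 0 ε, f y ≤ g y) : ballAverage p ε f ≤ ballAverage p ε g := by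
  unfold ballAverage
  have h1 : sSup (f '' Metric.ball 0 ε) ≤ sSup (g '' Metric.ball 0 ε) := by
    apply csSup_le (image_ball_nonempty hε f)
    rintro _ ⟨y, hy, rfl⟩
    exact (h y hy).trans (le_csSup hg.above ⟨y, hy, rfl⟩)
  have h2 : sInf (f '' Metric.ball 0 ε) ≤ sInf (g '' Metric.ball 0 ε) := by
    apply le_csInf (image_ball_nonempty hε g)
    rintro _ ⟨y, hy, rfl⟩
    exact (csInf_le hf.below ⟨y, hy, rfl⟩).trans (h y hy)
  have h3 : ⨍ y in Metric.ball 0 ε, f y ≤ ⨍ y in Metric.ball 0 ε, g y := by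
    rw [setAverage_eq, setAverage_eq]
    simp only [smul_eq_mul]
    exact mul_le_mul_of_nonneg_left (setIntegral_mono_on hf.integrable hg.integrable
      Metric.isOpen_ball.measurableSet h) (by positivity)
  have := weightTug_nonneg (N := N) hp
  have := weightNoise_pos (N := N) hp
  gcongr

theorem setAverage_ball_affine {ε : ℝ} (hε : 0 < ε) {f : EuclideanSpace ℝ (Fin N) → ℝ}
    (hf : IntegrableOn f (Metric.ball 0 ε)) (a k : ℝ) :
    ⨍ y in Metric.ball 0 ε, (a + k * f y) = a + k * ⨍ y in Metric.ball 0 ε, f y := by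
  have hpos := measureReal_ball_pos hε (0 : EuclideanSpace ℝ (Fin N))
  rw [setAverage_eq, setAverage_eq, integral_add (continuous_const.averageableOn ε).integrable (hf.const_mul k),
    integral_const_mul]
  simp only [smul_eq_mul, integral_const, measureReal_restrict_apply_univ]
  field_simp

/-- For `k < 0` supremum and infimum trade places, but they enter only through their sum. The case
`k = -1` later turns supersolutions into subsolutions. -/
theorem ballAverage_affine {p ε : ℝ} (hp : 2 ≤ p) (hε : 0 < ε)
    {f : EuclideanSpace ℝ (Fin N) → ℝ} (hf : AverageableOn ε f) (a k : ℝ) :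
    ballAverage p ε (fun y => a + k * f y) = a + k * ballAverage p ε f := by
  have hcont : Continuous fun c : ℝ => a + k * c := by fun_prop
  have himg : (fun y => a + k * f y) '' Metric.ball 0 ε =
      (fun c : ℝ => a + k * c) '' (f '' Metric.ball 0 ε) := by rw [image_image]
  have hne := image_ball_nonempty hε f
  have hsum : sSup ((fun y => a + k * f y) '' Metric.ball 0 ε) +
      sInf ((fun y => a + k * f y) '' Metric.ball 0 ε) =
      2 * a + k * (sSup (f '' Metric.ball 0 ε) + sInf (f '' Metric.ball 0 ε)) := by
    rw [himg]
    rcases le_total 0 k with hk | hk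
    · have hm : Monotone fun c : ℝ => a + k * c := fun c d hcd => by
        dsimp only; gcongr
      rw [← hm.map_csSup_of_continuousAt hcont.continuousAt hne hf.above,
        ← hm.map_csInf_of_continuousAt hcont.continuousAt hne hf.below]
      ring
    · have hm : Antitone fun c : ℝ => a + k * c := fun c d hcd => by
        dsimp only; linarith [mul_le_mul_of_nonpos_left hcd hk]
      rw [← hm.map_csSup_of_continuousAt hcont.continuousAt hne hf.above,
        ← hm.map_csInf_of_continuousAt hcont.continuousAt hne hf.below]
      ring
  rw [ballAverage, ballAverage, hsum, setAverage_ball_affine hε hf.integrable]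
  linear_combination a * weightTug_add_weightNoise (N := N) hp

/-- A monotone operator that commutes with adding constants is nonexpansive. -/
theorem ballAverage_sub_le {p ε : ℝ} (hp : 2 ≤ p) (hε : 0 < ε)
    {f g : EuclideanSpace ℝ (Fin N) → ℝ} (hf : AverageableOn ε f) (hg : AverageableOn ε g)
    {η : ℝ} (h : ∀ y ∈ Metric.ball 0 ε, |f y - g y| ≤ η) :
    |ballAverage p ε f - ballAverage p ε g| ≤ η := by
  have key : ∀ {f g : EuclideanSpace ℝ (Fin N) → ℝ}, AverageableOn ε f → AverageableOn ε g →
      (∀ y ∈ Metric.ball 0 ε, f y - g y ≤ η) → ballAverage p ε f ≤ η + ballAverage p ε g := by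
    intro f g hf hg h
    have h1 := ballAverage_affine hp hε hg η 1
    rw [one_mul] at h1
    rw [← h1]
    refine ballAverage_mono hp hε hf ⟨?_, ?_, ?_⟩ fun y hy => by linarith [h y hy]
    · obtain ⟨b, hb⟩ := hg.above
      refine ⟨η + b, ?_⟩
      rintro _ ⟨y, hy, rfl⟩
      have := hb ⟨y, hy, rfl⟩
      dsimp only; linarith
    · obtain ⟨b, hb⟩ := hg.below
      refine ⟨η + b, ?_⟩
      rintro _ ⟨y, hy, rfl⟩
      have := hb ⟨y, hy, rfl⟩
      dsimp only; linarith
    · exact Integrable.add (continuous_const.averageableOn ε).integrable (hg.integrable.const_mul 1)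
  rw [abs_le]
  have h1 := key hf hg fun y hy => (le_abs_self _).trans (h y hy)
  have h2 := key hg hf fun y hy => by
    have := (neg_le_abs (f y - g y)).trans (h y hy)
    linarith
  constructor <;> linarith

theorem ballAverage_const {p ε : ℝ} (hp : 2 ≤ p) (hε : 0 < ε) (c : ℝ) :
    ballAverage p ε (fun _ : EuclideanSpace ℝ (Fin N) => c) = c := by
  have := ballAverage_affine (N := N) hp hε (f := fun _ => 0)
    (continuous_const.averageableOn ε) c 0
  simpa using this

end BallAverage

/-! ### Gaussians under the one-step average -/

section Gaussian

variable {N : ℕ}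

/-- Since `cosh x = 1 + 2 sinh² (x/2)` and `sinh y ≥ y` for `y ≥ 0`. -/
theorem one_add_sq_half_le_cosh (x : ℝ) : 1 + x ^ 2 / 2 ≤ Real.cosh x := by
  wlog hx : 0 ≤ x generalizing x
  · have := this (-x) (by linarith)
    rwa [neg_sq, Real.cosh_neg] at this
  have h1 : x / 2 ≤ Real.sinh (x / 2) := Real.self_le_sinh_iff.2 (by linarith)
  have h2 : Real.cosh x = Real.cosh (x / 2) ^ 2 + Real.sinh (x / 2) ^ 2 := by
    rw [← Real.cosh_two_mul]; congr 1; ring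
  rw [h2, Real.cosh_sq]
  nlinarith

/-- The Gaussian profile `exp (-lam ‖v‖²)`. -/
noncomputable def gaussian (lam : ℝ) (v : EuclideanSpace ℝ (Fin N)) : ℝ :=
  Real.exp (-(lam * ‖v‖ ^ 2))

theorem continuous_gaussian (lam : ℝ) :
    Continuous (gaussian lam : EuclideanSpace ℝ (Fin N) → ℝ) := by
  unfold gaussian
  fun_prop

theorem gaussian_pos (lam : ℝ) (v : EuclideanSpace ℝ (Fin N)) : 0 < gaussian lam v :=
  Real.exp_pos _

/-- The product is at least `(1 - ε)(1 + 2s)`; half of `2s` absorbs the cross term because `ε ≤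
1/2`. Here `ε` bounds an exponent and is not the step size. -/
theorem one_add_le_exp_neg_mul_cosh {a ε b s : ℝ} (ha : 0 ≤ a) (hae : a ≤ ε)
    (hε : ε ≤ 1 / 2) (hb : b ^ 2 = 4 * s) :
    1 - ε + s ≤ Real.exp (-a) * Real.cosh b := by
  have h1 : 1 - a ≤ Real.exp (-a) := by linarith [Real.add_one_le_exp (-a)]
  have h2 := one_add_sq_half_le_cosh b
  have hs : 0 ≤ s := by nlinarith [sq_nonneg b]
  calc 1 - ε + s ≤ (1 - a) * (1 + b ^ 2 / 2) := by rw [hb]; nlinarith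
    _ ≤ Real.exp (-a) * Real.cosh b := by gcongr

/-- The profile decreases radially, so it suffices to compare with its values at radii `‖v‖ - ε` and
`‖v‖ + ε`, whose sum factors through a `cosh`. -/
theorem sup_add_inf_gaussian_ge {lam ε : ℝ} (hlam : 0 ≤ lam) (hε : 0 < ε)
    (hle : lam * ε ^ 2 ≤ 1 / 2) (v : EuclideanSpace ℝ (Fin N)) :
    2 * (gaussian lam v * (1 - lam * ε ^ 2 + lam ^ 2 * ‖v‖ ^ 2 * ε ^ 2)) ≤
      sSup ((fun h => gaussian lam (v + h)) '' Metric.ball 0 ε) +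
        sInf ((fun h => gaussian lam (v + h)) '' Metric.ball 0 ε) := by
  have hc : Continuous fun h => gaussian lam (v + h) :=
    (continuous_gaussian lam).comp (by fun_prop)
  have hav := hc.averageableOn ε
  have hinf : Real.exp (-(lam * (‖v‖ + ε) ^ 2)) ≤
      sInf ((fun h => gaussian lam (v + h)) '' Metric.ball 0 ε) := by
    apply le_csInf (image_ball_nonempty hε _)
    rintro _ ⟨h, hh, rfl⟩
    have hh' : ‖h‖ < ε := by simpa using hh
    have : ‖v + h‖ ≤ ‖v‖ + ε := (norm_add_le _ _).trans (by linarith)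
    exact Real.exp_le_exp.2 (neg_le_neg (mul_le_mul_of_nonneg_left
      (pow_le_pow_left₀ (norm_nonneg _) this 2) hlam))
  have hsup : Real.exp (-(lam * (‖v‖ - ε) ^ 2)) ≤
      sSup ((fun h => gaussian lam (v + h)) '' Metric.ball 0 ε) := by
    rcases lt_or_ge ‖v‖ ε with hv | hv
    · refine le_trans ?_ (le_csSup hav.above ⟨-v, by simpa using hv, rfl⟩)
      simp only [add_neg_cancel, gaussian, norm_zero]
      rw [Real.exp_le_exp]
      nlinarith [mul_nonneg hlam (sq_nonneg (‖v‖ - ε))]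
    · have hv0 : 0 < ‖v‖ := hε.trans_le hv
      -- The ball is open, so a move of length `ε` towards the origin is reached only as a limit of
      -- moves of length `s < ε`.
      have hcl : ∀ s ∈ Ico 0 ε, Real.exp (-(lam * (‖v‖ - s) ^ 2)) ≤
          sSup ((fun h => gaussian lam (v + h)) '' Metric.ball 0 ε) := by
        intro s hs
        refine le_trans ?_ (le_csSup hav.above ⟨-((s / ‖v‖) • v), ?_, rfl⟩)
        · have h1 : v + -((s / ‖v‖) • v) = (1 - s / ‖v‖) • v := by
            rw [sub_smul, one_smul, sub_eq_add_neg]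
          have h2 : ‖(1 - s / ‖v‖) • v‖ ^ 2 = (‖v‖ - s) ^ 2 := by
            rw [norm_smul, mul_pow, Real.norm_eq_abs, sq_abs]
            field_simp
          simp only [h1]
          unfold gaussian
          rw [h2]
        · rw [mem_ball_zero_iff, norm_neg, norm_smul, Real.norm_eq_abs,
            abs_of_nonneg (div_nonneg hs.1 hv0.le), div_mul_cancel₀ _ hv0.ne']
          exact hs.2
      have hcl2 : ∀ s ∈ closure (Ico 0 ε), Real.exp (-(lam * (‖v‖ - s) ^ 2)) ≤
          sSup ((fun h => gaussian lam (v + h)) '' Metric.ball 0 ε) := fun s hs =>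
        closure_minimal hcl (isClosed_le
          (f := fun s => Real.exp (-(lam * (‖v‖ - s) ^ 2))) (by fun_prop) continuous_const) hs
      exact hcl2 ε (by rw [closure_Ico hε.ne]; exact ⟨hε.le, le_rfl⟩)
  refine le_trans ?_ (add_le_add hsup hinf)
  have e1 : Real.exp (-(lam * (‖v‖ - ε) ^ 2)) + Real.exp (-(lam * (‖v‖ + ε) ^ 2)) =
      2 * (gaussian lam v * (Real.exp (-(lam * ε ^ 2)) * Real.cosh (2 * lam * ‖v‖ * ε))) := by
    rw [Real.cosh_eq]
    unfold gaussian
    have a1 : -(lam * (‖v‖ - ε) ^ 2) =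
      -(lam * ‖v‖ ^ 2) + (-(lam * ε ^ 2)) + 2 * lam * ‖v‖ * ε := by ring
    have a2 : -(lam * (‖v‖ + ε) ^ 2) =
      -(lam * ‖v‖ ^ 2) + (-(lam * ε ^ 2)) + -(2 * lam * ‖v‖ * ε) := by ring
    rw [a1, a2]
    simp only [Real.exp_add]
    ring
  rw [e1]
  have := gaussian_pos lam v
  gcongr
  exact one_add_le_exp_neg_mul_cosh (by positivity) le_rfl hle (by ring)

theorem gaussian_add_add_gaussian_sub (lam : ℝ) (v h : EuclideanSpace ℝ (Fin N)) :
    gaussian lam (v + h) + gaussian lam (v + -h) = 2 * (gaussian lam v *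
      (Real.exp (-(lam * ‖h‖ ^ 2)) * Real.cosh (2 * lam * inner ℝ v h))) := by
  rw [Real.cosh_eq]
  unfold gaussian
  have a1 : -(lam * ‖v + h‖ ^ 2) =
      -(lam * ‖v‖ ^ 2) + (-(lam * ‖h‖ ^ 2)) + -(2 * lam * inner ℝ v h) := by
    rw [norm_add_sq_real]; ring
  have a2 : -(lam * ‖v + -h‖ ^ 2) =
      -(lam * ‖v‖ ^ 2) + (-(lam * ‖h‖ ^ 2)) + 2 * lam * inner ℝ v h := by
    rw [norm_add_sq_real, inner_neg_right, norm_neg]; ring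
  rw [a1, a2]
  simp only [Real.exp_add]
  ring

theorem setIntegral_ball_neg (ε : ℝ) (f : EuclideanSpace ℝ (Fin N) → ℝ) :
    ∫ h in Metric.ball 0 ε, f (-h) = ∫ h in Metric.ball 0 ε, f h := by
  have h := (Measure.measurePreserving_neg (volume : Measure (EuclideanSpace ℝ (Fin N))))
    |>.setIntegral_preimage_emb (MeasurableEquiv.neg _).measurableEmbedding f (Metric.ball 0 ε)
  rw [← h]
  congr 2
  ext y
  simp

/-- A lower bound for the normalised second moment of a ball in a direction. -/
noncomputable def momentConstant (N : ℕ) : ℝ := (1 / 4) ^ N / 16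

theorem momentConstant_pos : 0 < momentConstant N := by
  unfold momentConstant
  positivity

theorem momentConstant_le_one : momentConstant N ≤ 1 := by
  unfold momentConstant
  have : ((1 : ℝ) / 4) ^ N ≤ 1 := pow_le_one₀ (by norm_num) (by norm_num)
  linarith

/-- Keep only the ball of radius `ε/4` about the point at distance `ε/2` along `v`: there the inner
product is at least `ε‖v‖/4`, and the volume fraction is `(1/4)^N`. -/
theorem setAverage_inner_sq_ge {ε : ℝ} (hε : 0 < ε) (v : EuclideanSpace ℝ (Fin N)) :
    momentConstant N * ‖v‖ ^ 2 * ε ^ 2 ≤ ⨍ h in Metric.ball 0 ε, (inner ℝ v h : ℝ) ^ 2 := by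
  have hint : IntegrableOn (fun h : EuclideanSpace ℝ (Fin N) => (inner ℝ v h : ℝ) ^ 2)
      (Metric.ball 0 ε) :=
    (Continuous.averageableOn (by fun_prop) ε).integrable
  rcases eq_or_ne v 0 with rfl | hv
  · simp
  have hv0 : 0 < ‖v‖ := norm_pos_iff.2 hv
  set c : EuclideanSpace ℝ (Fin N) := (ε / (2 * ‖v‖)) • v with hc
  have hcn : ‖c‖ = ε / 2 := by
    rw [hc, norm_smul, Real.norm_eq_abs, abs_of_pos (by positivity)]
    field_simp
  have hsub : Metric.ball c (ε / 4) ⊆ Metric.ball 0 ε :=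
    Metric.ball_subset_ball' (by rw [dist_zero_right, hcn]; linarith)
  have hlow : ∀ h ∈ Metric.ball c (ε / 4), (ε / 4 * ‖v‖) ^ 2 ≤ (inner ℝ v h : ℝ) ^ 2 := by
    intro h hh
    have h1 : (inner ℝ v h : ℝ) = inner ℝ v c + inner ℝ v (h - c) := by
      rw [← inner_add_right]; simp
    have h2 : (inner ℝ v c : ℝ) = ε / 2 * ‖v‖ := by
      rw [hc, real_inner_smul_right, real_inner_self_eq_norm_sq]
      field_simp
    have h3 : |(inner ℝ v (h - c) : ℝ)| ≤ ‖v‖ * (ε / 4) :=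
      (abs_real_inner_le_norm _ _).trans
        (mul_le_mul_of_nonneg_left (mem_ball_iff_norm.1 hh).le hv0.le)
    have h4 := (abs_le.1 h3).1
    exact pow_le_pow_left₀ (by positivity) (by rw [h1, h2]; linarith) 2
  have hpos := measureReal_ball_pos hε (0 : EuclideanSpace ℝ (Fin N))
  have hvol : volume.real (Metric.ball c (ε / 4)) =
      (1 / 4) ^ N * volume.real (Metric.ball (0 : EuclideanSpace ℝ (Fin N)) ε) := by
    have := Measure.addHaar_ball_mul_of_pos (volume : Measure (EuclideanSpace ℝ (Fin N))) c
      (r := 1 / 4) (by norm_num) ε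
    rw [show ε / 4 = 1 / 4 * ε by ring, measureReal_def, this, ENNReal.toReal_mul,
      ENNReal.toReal_ofReal (by positivity), finrank_euclideanSpace_fin, measureReal_def]
  have hI : (ε / 4 * ‖v‖) ^ 2 * volume.real (Metric.ball c (ε / 4)) ≤
      ∫ h in Metric.ball 0 ε, (inner ℝ v h : ℝ) ^ 2 := by
    calc (ε / 4 * ‖v‖) ^ 2 * volume.real (Metric.ball c (ε / 4))
        = ∫ _ in Metric.ball c (ε / 4), (ε / 4 * ‖v‖) ^ 2 := by
          simp [mul_comm]
      _ ≤ ∫ h in Metric.ball c (ε / 4), (inner ℝ v h : ℝ) ^ 2 :=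
          setIntegral_mono_on ((continuous_const.averageableOn ε).integrable.mono_set hsub)
            (hint.mono_set hsub)
            Metric.isOpen_ball.measurableSet hlow
      _ ≤ ∫ h in Metric.ball 0 ε, (inner ℝ v h : ℝ) ^ 2 :=
          setIntegral_mono_set hint (ae_of_all _ fun _ => sq_nonneg _)
            (LE.le.eventuallyLE hsub)
  rw [setAverage_eq, smul_eq_mul, inv_mul_eq_div, le_div_iff₀ hpos]
  refine le_trans (le_of_eq ?_) hI
  rw [hvol, momentConstant]
  ring

/-- Pairing `h` with `-h` cancels the odd part and leaves a `cosh`, whose quadratic term averages to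
the second moment of the ball. -/
theorem setAverage_gaussian_ge {lam ε : ℝ} (hlam : 0 ≤ lam) (hε : 0 < ε)
    (hle : lam * ε ^ 2 ≤ 1 / 2) (v : EuclideanSpace ℝ (Fin N)) :
    gaussian lam v * (1 - lam * ε ^ 2 + lam ^ 2 * momentConstant N * ‖v‖ ^ 2 * ε ^ 2) ≤
      ⨍ h in Metric.ball 0 ε, gaussian lam (v + h) := by
  have hpos := measureReal_ball_pos hε (0 : EuclideanSpace ℝ (Fin N))
  have hc : Continuous fun h => gaussian lam (v + h) :=
    (continuous_gaussian lam).comp (by fun_prop)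
  have hc' : Continuous fun h => gaussian lam (v + -h) :=
    (continuous_gaussian lam).comp (by fun_prop)
  have hq : Continuous fun h : EuclideanSpace ℝ (Fin N) => (inner ℝ v h : ℝ) ^ 2 := by fun_prop
  have hsym : 2 * ∫ h in Metric.ball 0 ε, gaussian lam (v + h) =
      ∫ h in Metric.ball 0 ε, (gaussian lam (v + h) + gaussian lam (v + -h)) := by
    rw [integral_add (hc.averageableOn ε).integrable (hc'.averageableOn ε).integrable,
      setIntegral_ball_neg ε fun h => gaussian lam (v + h)]
    ring
  have hg := gaussian_pos lam v
  have hpt : ∀ h ∈ Metric.ball (0 : EuclideanSpace ℝ (Fin N)) ε,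
      2 * gaussian lam v * (1 - lam * ε ^ 2) +
        2 * gaussian lam v * lam ^ 2 * (inner ℝ v h : ℝ) ^ 2 ≤
      gaussian lam (v + h) + gaussian lam (v + -h) := by
    intro h hh
    have hh' : ‖h‖ ≤ ε := (mem_ball_zero_iff.1 hh).le
    rw [gaussian_add_add_gaussian_sub]
    have := one_add_le_exp_neg_mul_cosh (a := lam * ‖h‖ ^ 2) (ε := lam * ε ^ 2)
      (b := 2 * lam * inner ℝ v h) (s := lam ^ 2 * (inner ℝ v h : ℝ) ^ 2)
      (by positivity) (by gcongr) hle (by ring)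
    calc _ = 2 * (gaussian lam v *
        (1 - lam * ε ^ 2 + lam ^ 2 * (inner ℝ v h : ℝ) ^ 2)) := by ring
      _ ≤ _ := by gcongr
  have hmono := setIntegral_mono_on
    (Continuous.averageableOn (N := N) (f := fun h => 2 * gaussian lam v * (1 - lam * ε ^ 2) +
        2 * gaussian lam v * lam ^ 2 * (inner ℝ v h : ℝ) ^ 2) (by fun_prop) ε).integrable
    ((hc.add hc').averageableOn ε).integrable Metric.isOpen_ball.measurableSet hpt
  have haff := setAverage_ball_affine hε (hq.averageableOn ε).integrable
    (2 * gaussian lam v * (1 - lam * ε ^ 2)) (2 * gaussian lam v * lam ^ 2)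
  have hmom := setAverage_inner_sq_ge hε v
  have hA : 2 * gaussian lam v * (1 - lam * ε ^ 2) + 2 * gaussian lam v * lam ^ 2 *
      ⨍ h in Metric.ball 0 ε, (inner ℝ v h : ℝ) ^ 2 ≤
      2 * ⨍ h in Metric.ball 0 ε, gaussian lam (v + h) := by
    rw [← haff, setAverage_eq, setAverage_eq]
    simp only [smul_eq_mul]
    rw [mul_left_comm, hsym]
    exact mul_le_mul_of_nonneg_left hmono (by positivity)
  have := mul_le_mul_of_nonneg_left hmom (by positivity : 0 ≤ 2 * gaussian lam v * lam ^ 2)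
  linarith

theorem ballAverage_gaussian_ge {p lam ε : ℝ} (hp : 2 ≤ p) (hlam : 0 ≤ lam) (hε : 0 < ε)
    (hle : lam * ε ^ 2 ≤ 1 / 2) (v : EuclideanSpace ℝ (Fin N)) :
    gaussian lam v * (1 - lam * ε ^ 2 + lam ^ 2 * momentConstant N * ‖v‖ ^ 2 * ε ^ 2) ≤
      ballAverage p ε (fun h => gaussian lam (v + h)) := by
  have h1 := sup_add_inf_gaussian_ge hlam hε hle v
  have h2 := setAverage_gaussian_ge hlam hε hle v
  have ha := weightTug_nonneg (N := N) hp
  have hb := weightNoise_pos (N := N) hp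
  have hab := weightTug_add_weightNoise (N := N) hp
  have hg := gaussian_pos lam v
  have h3 : gaussian lam v *
      (1 - lam * ε ^ 2 + lam ^ 2 * momentConstant N * ‖v‖ ^ 2 * ε ^ 2) ≤
      gaussian lam v * (1 - lam * ε ^ 2 + lam ^ 2 * ‖v‖ ^ 2 * ε ^ 2) := by
    gcongr gaussian lam v * (1 - lam * ε ^ 2 + ?_ * _ * _)
    exact mul_le_of_le_one_right (by positivity) momentConstant_le_one
  unfold ballAverage
  set A := gaussian lam v *
      (1 - lam * ε ^ 2 + lam ^ 2 * momentConstant N * ‖v‖ ^ 2 * ε ^ 2)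
  calc A = weightTug N p / 2 * (2 * A) + weightNoise N p * A := by
        linear_combination (-A) * hab
    _ ≤ _ := add_le_add
        (mul_le_mul_of_nonneg_left ((mul_le_mul_of_nonneg_left h3 zero_le_two).trans h1)
          (by linarith)) (mul_le_mul_of_nonneg_left h2 hb.le)

end Gaussian

/-! ### Comparison by induction over time steps -/

section Comparison

variable {N : ℕ} {Ω : Set (EuclideanSpace ℝ (Fin N))} {T p ε : ℝ}
  {ψ F v w : EuclideanSpace ℝ (Fin N) × ℝ → ℝ}

/-- The set on which a solution of the dynamic programming principle is determined. -/
def gameDomain (Ω : Set (EuclideanSpace ℝ (Fin N))) (T ε : ℝ) :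
    Set (EuclideanSpace ℝ (Fin N) × ℝ) :=
  (Ω ×ˢ Ioc 0 T) ∪ parabolicStrip Ω T ε

theorem exists_mem_frontier_of_mem_of_notMem (hΩ : IsOpen Ω) {x y : EuclideanSpace ℝ (Fin N)}
    (hx : x ∈ Ω) (hy : y ∉ Ω) :
    ∃ f ∈ frontier Ω, dist f x ≤ dist x y ∧ dist f y ≤ dist x y := by
  have hpre := (convex_segment (𝕜 := ℝ) x y).isPreconnected
  have hex : ∃ f ∈ frontier Ω, f ∈ segment ℝ x y := by
    by_contra! hcon
    have hsub : segment ℝ x y ⊆ Ω := by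
      refine hpre.subset_of_closure_inter_subset hΩ ⟨x, left_mem_segment ℝ x y, hx⟩ ?_
      rintro f ⟨hf, hfs⟩
      by_contra hfΩ
      exact hcon f (by rw [hΩ.frontier_eq]; exact ⟨hf, hfΩ⟩) hfs
    exact hy (hsub (right_mem_segment ℝ x y))
  obtain ⟨f, hf, hfs⟩ := hex
  have h1 := dist_add_dist_of_mem_segment hfs
  refine ⟨f, hf, ?_, ?_⟩
  · rw [dist_comm f x]
    linarith [dist_nonneg (x := f) (y := y)]
  · linarith [dist_nonneg (x := x) (y := f)]

theorem add_mem_gameDomain (hΩ : IsOpen Ω) (hε : 0 < ε) {x h : EuclideanSpace ℝ (Fin N)} (hx : x ∈ Ω)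
    (hh : h ∈ Metric.ball 0 ε) {t : ℝ} (ht : t ∈ Ioc 0 T) :
    (x + h, t - ε ^ 2 / 2) ∈ gameDomain Ω T ε := by
  have hh' : ‖h‖ < ε := mem_ball_zero_iff.1 hh
  have hε2 : 0 < ε ^ 2 := by positivity
  obtain ⟨ht0, htT⟩ := ht
  by_cases hxh : x + h ∈ Ω
  · rcases le_or_gt (t - ε ^ 2 / 2) 0 with h0 | h0
    · exact Or.inr (Or.inr ⟨hxh, by dsimp only; linarith, h0⟩)
    · exact Or.inl ⟨hxh, h0, by dsimp only; linarith⟩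
  · obtain ⟨f, hf, -, hfd⟩ := exists_mem_frontier_of_mem_of_notMem hΩ hx hxh
    refine Or.inr (Or.inl ⟨⟨hxh, (Metric.infDist_le_dist_of_mem hf).trans ?_⟩, ?_, ?_⟩)
    · rw [dist_comm]
      refine hfd.trans ?_
      simpa using hh'.le
    · dsimp only; linarith
    · dsimp only; linarith

/-- Each step goes back by the fixed time `ε²/2`, so the strip is reached after finitely many steps.
-/
theorem gameDomain_induction (hΩ : IsOpen Ω) (hε : 0 < ε) {P : EuclideanSpace ℝ (Fin N) × ℝ → Prop}
    (hstrip : ∀ z ∈ parabolicStrip Ω T ε, P z)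
    (hstep : ∀ x ∈ Ω, ∀ t ∈ Ioc 0 T, (∀ h ∈ Metric.ball 0 ε, P (x + h, t - ε ^ 2 / 2)) →
      P (x, t)) : ∀ z ∈ gameDomain Ω T ε, P z := by
  have hε2 : 0 < ε ^ 2 / 2 := by positivity
  have key : ∀ n : ℕ, ∀ x ∈ Ω, ∀ t ∈ Ioc 0 T, t ≤ n * (ε ^ 2 / 2) → P (x, t) := by
    intro n
    induction n with
    | zero =>
      intro x _ t ht hn
      exact absurd ht.1 (not_lt.2 (by simpa using hn))
    | succ n ih =>
      intro x hx t ht hn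
      refine hstep x hx t ht fun h hh => ?_
      rcases add_mem_gameDomain hΩ hε hx hh ht with hm | hm
      · refine ih _ hm.1 _ hm.2 ?_
        push_cast at hn
        linarith
      · exact hstrip _ hm
  rintro ⟨x, t⟩ (hz | hz)
  · obtain ⟨n, hn⟩ := exists_nat_ge (t / (ε ^ 2 / 2))
    exact key n x hz.1 t hz.2 (by rwa [div_le_iff₀ hε2] at hn)
  · exact hstrip _ hz

theorem IsDPPSolution.averageableOn (hv : IsDPPSolution Ω T p ε ψ F v) (hΩ : IsOpen Ω)
    (hε : 0 < ε)
    {x : EuclideanSpace ℝ (Fin N)} (hx : x ∈ Ω) {t : ℝ} (ht : t ∈ Ioc 0 T) :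
    AverageableOn ε (fun h => v (x + h, t - ε ^ 2 / 2)) := by
  obtain ⟨M, hM⟩ := hv.bounded
  have hbd : ∀ h ∈ Metric.ball 0 ε, |v (x + h, t - ε ^ 2 / 2)| ≤ M := fun h hh =>
    hM _ (add_mem_gameDomain hΩ hε hx hh ht)
  refine ⟨⟨M, ?_⟩, ⟨-M, ?_⟩, ?_⟩
  · rintro _ ⟨h, hh, rfl⟩
    exact (abs_le.1 (hbd h hh)).2
  · rintro _ ⟨h, hh, rfl⟩
    exact (abs_le.1 (hbd h hh)).1
  · have hmeas : Measurable fun h : Metric.ball (0 : EuclideanSpace ℝ (Fin N)) ε =>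
        v (x + h, t - ε ^ 2 / 2) := by
      have hmap : Measurable fun h : Metric.ball (0 : EuclideanSpace ℝ (Fin N)) ε =>
          (⟨(x + h, t - ε ^ 2 / 2), add_mem_gameDomain hΩ hε hx h.2 ht⟩ : gameDomain Ω T ε) := by
        apply Measurable.subtype_mk
        fun_prop
      exact hv.borel.comp hmap
    have hae := (aemeasurable_restrict_of_measurable_subtype (μ := volume)
      (f := fun h => v (x + h, t - ε ^ 2 / 2))
      Metric.isOpen_ball.measurableSet hmeas).aestronglyMeasurable
    exact IntegrableOn.of_bound measure_ball_lt_top hae M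
      ((ae_restrict_iff' Metric.isOpen_ball.measurableSet).2 (ae_of_all _ hbd))

theorem IsDPPSolution.le_of_supersolution (hv : IsDPPSolution Ω T p ε ψ F v) (hΩ : IsOpen Ω)
    (hp : 2 ≤ p)
    (hε : 0 < ε) (hw : ∀ t, Continuous fun y => w (y, t))
    (hstrip : ∀ z ∈ parabolicStrip Ω T ε, F z ≤ w z)
    (hobst : ∀ x ∈ Ω, ∀ t ∈ Ioc 0 T, ψ (x, t) ≤ w (x, t))
    (hsuper : ∀ x ∈ Ω, ∀ t ∈ Ioc 0 T, gameAverage p ε w x t ≤ w (x, t)) :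
    ∀ z ∈ gameDomain Ω T ε, v z ≤ w z := by
  refine gameDomain_induction hΩ hε (fun z hz => (hv.boundary z hz).trans_le (hstrip z hz)) ?_
  intro x hx t ht ih
  rw [hv.dpp x hx t ht]
  refine max_le (hobst x hx t ht) (le_trans ?_ (hsuper x hx t ht))
  rw [gameAverage_eq_ballAverage, gameAverage_eq_ballAverage]
  refine ballAverage_mono hp hε (hv.averageableOn hΩ hε hx ht) ?_ ih
  exact ((hw _).comp (continuous_const.add continuous_id)).averageableOn ε

/-- The maximum with `ψ` only raises `v`, so a lower barrier need not be compared with the obstacle.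
-/
theorem IsDPPSolution.ge_of_subsolution (hv : IsDPPSolution Ω T p ε ψ F v) (hΩ : IsOpen Ω)
    (hp : 2 ≤ p)
    (hε : 0 < ε) (hw : ∀ t, Continuous fun y => w (y, t))
    (hstrip : ∀ z ∈ parabolicStrip Ω T ε, w z ≤ F z)
    (hsub : ∀ x ∈ Ω, ∀ t ∈ Ioc 0 T, w (x, t) ≤ gameAverage p ε w x t) :
    ∀ z ∈ gameDomain Ω T ε, w z ≤ v z := by
  refine gameDomain_induction hΩ hε (fun z hz => (hstrip z hz).trans_eq (hv.boundary z hz).symm) ?_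
  intro x hx t ht ih
  rw [hv.dpp x hx t ht]
  refine le_max_of_le_right ((hsub x hx t ht).trans ?_)
  rw [gameAverage_eq_ballAverage, gameAverage_eq_ballAverage]
  refine ballAverage_mono hp hε ?_ (hv.averageableOn hΩ hε hx ht) ih
  exact ((hw _).comp (continuous_const.add continuous_id)).averageableOn ε

theorem IsDPPSolution.abs_le_bound (hv : IsDPPSolution Ω T p ε ψ F v) (hΩ : IsOpen Ω)
    (hp : 2 ≤ p) (hε : 0 < ε)
    {M : ℝ} (hF : ∀ z ∈ parabolicStrip Ω T ε, |F z| ≤ M) (hψ : ∀ z, |ψ z| ≤ M) :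
    ∀ z ∈ gameDomain Ω T ε, |v z| ≤ M := by
  have h1 := hv.le_of_supersolution (w := fun _ => M) hΩ hp hε (fun _ => continuous_const)
    (fun z hz => (abs_le.1 (hF z hz)).2) (fun x _ t _ => (abs_le.1 (hψ _)).2)
    (fun x _ t _ => by rw [gameAverage_eq_ballAverage, ballAverage_const hp hε])
  have h2 := hv.ge_of_subsolution (w := fun _ => -M) hΩ hp hε (fun _ => continuous_const)
    (fun z hz => (abs_le.1 (hF z hz)).1)
    (fun x _ t _ => by rw [gameAverage_eq_ballAverage, ballAverage_const hp hε])
  exact fun z hz => abs_le.2 ⟨h2 z hz, h1 z hz⟩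

/-- A nonnegative-modulus barrier `W` at a parabolic boundary point `b` confines the solution. -/
theorem IsDPPSolution.abs_sub_le_of_barrier (hv : IsDPPSolution Ω T p ε ψ F v) (hΩ : IsOpen Ω)
    (hp : 2 ≤ p)
    (hε : 0 < ε) {W : EuclideanSpace ℝ (Fin N) × ℝ → ℝ} (hW : ∀ t, Continuous fun y => W (y, t))
    {b : EuclideanSpace ℝ (Fin N) × ℝ} (hψb : ψ b ≤ F b)
    (hFW : ∀ z ∈ parabolicStrip Ω T ε, |F z - F b| ≤ W z)
    (hψW : ∀ x ∈ Ω, ∀ t ∈ Ioc 0 T, |ψ (x, t) - ψ b| ≤ W (x, t))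
    (hsuper : ∀ x ∈ Ω, ∀ t ∈ Ioc 0 T, gameAverage p ε W x t ≤ W (x, t)) :
    ∀ z ∈ gameDomain Ω T ε, |v z - F b| ≤ W z := by
  have hav : ∀ x t, AverageableOn ε (fun h => W (x + h, t - ε ^ 2 / 2)) := fun x t =>
    ((hW _).comp (continuous_const.add continuous_id)).averageableOn ε
  have h1 := hv.le_of_supersolution (w := fun z => F b + 1 * W z) hΩ hp hε
    (fun t => continuous_const.add (continuous_const.mul (hW t)))
    (fun z hz => by linarith [(abs_le.1 (hFW z hz)).2])
    -- `ψ ≤ ψ b + W ≤ F b + W`, by `hψb`.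
    (fun x hx t ht => by linarith [(abs_le.1 (hψW x hx t ht)).2])
    (fun x hx t ht => by
      have := hsuper x hx t ht
      rw [gameAverage_eq_ballAverage] at this ⊢
      rw [ballAverage_affine hp hε (hav x t)]
      linarith)
  have h2 := hv.ge_of_subsolution (w := fun z => F b + (-1) * W z) hΩ hp hε
    (fun t => continuous_const.add (continuous_const.mul (hW t)))
    (fun z hz => by linarith [(abs_le.1 (hFW z hz)).1])
    (fun x hx t ht => by
      have := hsuper x hx t ht
      rw [gameAverage_eq_ballAverage] at this ⊢
      rw [ballAverage_affine hp hε (hav x t)]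
      linarith)
  intro z hz
  rw [abs_le]
  constructor
  · linarith [h2 z hz]
  · linarith [h1 z hz]

end Comparison

/-! ### Barriers at the parabolic boundary -/

section Boundary

variable {N : ℕ} {Ω : Set (EuclideanSpace ℝ (Fin N))} {T p : ℝ}

/-- Where `C‖x - y‖ ≥ η/2`, compactness bounds `g` below by a positive number, so a large multiple
dominates; elsewhere `η` suffices. The strict inequality persists on a neighbourhood of `S`, needed
because the strips protrude from `closure Ω`. -/
theorem exists_linear_le_of_unique_zero {S : Set (EuclideanSpace ℝ (Fin N))} (hS : IsCompact S)
    {g : EuclideanSpace ℝ (Fin N) → ℝ} (hg : Continuous g) (hg0 : ∀ x ∈ S, 0 ≤ g x)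
    {y : EuclideanSpace ℝ (Fin N)} (hgy : ∀ x ∈ S, g x = 0 → x = y) (C : ℝ) {η : ℝ}
    (hη : 0 < η) :
    ∃ K₀ : ℝ, 0 ≤ K₀ ∧ ∀ K ≥ K₀, ∃ ε₁ > 0, ∀ x ∈ Metric.cthickening ε₁ S,
      C * ‖x - y‖ ≤ η + K * g x := by
  have hlin : Continuous fun x => C * ‖x - y‖ := by fun_prop
  suffices h : ∃ K₀ : ℝ, 0 ≤ K₀ ∧ ∀ K ≥ K₀, ∀ x ∈ S, C * ‖x - y‖ < η + K * g x by
    obtain ⟨K₀, hK₀, h⟩ := h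
    refine ⟨K₀, hK₀, fun K hK => ?_⟩
    obtain ⟨δ, hδ, hsub⟩ := hS.exists_cthickening_subset_open
      (isOpen_lt hlin (by fun_prop : Continuous fun x => η + K * g x)) (h K hK)
    exact ⟨δ, hδ, fun x hx => (hsub hx).le⟩
  have hS' : IsCompact (S ∩ {x | η / 2 ≤ C * ‖x - y‖}) :=
    hS.inter_right (isClosed_le continuous_const hlin)
  rcases (S ∩ {x | η / 2 ≤ C * ‖x - y‖}).eq_empty_or_nonempty with he | hne
  · refine ⟨0, le_rfl, fun K hK x hx => ?_⟩
    have h1 : C * ‖x - y‖ < η / 2 := by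
      by_contra! hcon
      exact he.subset ⟨hx, hcon⟩
    linarith [mul_nonneg hK (hg0 x hx)]
  · obtain ⟨x₀, hx₀, hmin⟩ := hS'.exists_isMinOn hne hg.continuousOn
    obtain ⟨x₁, hx₁, hmax⟩ := hS'.exists_isMaxOn hne hlin.continuousOn
    have hpos : 0 < g x₀ := by
      refine lt_of_le_of_ne (hg0 x₀ hx₀.1) fun h0 => ?_
      have := hx₀.2
      rw [hgy x₀ hx₀.1 h0.symm] at this
      simp at this
      linarith
    have hB : 0 < C * ‖x₁ - y‖ := (half_pos hη).trans_le hx₁.2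
    refine ⟨C * ‖x₁ - y‖ / g x₀, by positivity, fun K hK x hx => ?_⟩
    have hK0 : 0 ≤ K := le_trans (by positivity) hK
    rcases lt_or_ge (C * ‖x - y‖) (η / 2) with hlt | hge
    · linarith [mul_nonneg hK0 (hg0 x hx)]
    · have h1 : C * ‖x - y‖ ≤ C * ‖x₁ - y‖ := hmax ⟨hx, hge⟩
      have h2 : g x₀ ≤ g x := hmin ⟨hx, hge⟩
      have h3 : C * ‖x₁ - y‖ ≤ K * g x₀ := (div_le_iff₀ hpos).1 hK
      have h4 := mul_le_mul_of_nonneg_left h2 hK0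
      linarith

/-- Young's inequality: the square-root modulus in time is traded for a linear term, which a barrier
can carry. -/
theorem mul_rpow_half_le (C τ : ℝ) {η : ℝ} (hη : 0 < η) :
    C * |τ| ^ (1 / 2 : ℝ) ≤ η + C ^ 2 / (4 * η) * |τ| := by
  rw [← Real.sqrt_eq_rpow]
  have h := Real.sq_sqrt (abs_nonneg τ)
  set s := √|τ|
  rw [← h]
  have : η + C ^ 2 / (4 * η) * s ^ 2 - C * s = (C * s / (2 * η) - 1) ^ 2 * η := by
    field_simp
    ring
  have h2 : 0 ≤ (C * s / (2 * η) - 1) ^ 2 * η := by positivity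
  linarith

theorem mem_cthickening_of_mem_spaceStrip (hne : Ω.Nonempty)
    (hΩb : Bornology.IsBounded Ω) {ε : ℝ} {x : EuclideanSpace ℝ (Fin N)}
    (hx : x ∈ spaceStrip Ω ε) : x ∈ Metric.cthickening ε (closure Ω) := by
  have hfr : (frontier Ω).Nonempty :=
    nonempty_frontier_iff.2 ⟨hne, fun h => hx.1 (h ▸ mem_univ x)⟩
  have hcomp : IsCompact (frontier Ω) :=
    hΩb.isCompact_closure.of_isClosed_subset isClosed_frontier frontier_subset_closure
  obtain ⟨f, hf, hfd⟩ := hcomp.exists_infDist_eq_dist hfr x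
  exact Metric.mem_cthickening_of_dist_le x f ε _ (frontier_subset_closure hf)
    (hfd ▸ hx.2)

theorem mem_of_mem_parabolicStrip (hne : Ω.Nonempty) (hΩb : Bornology.IsBounded Ω) (hT : 0 < T)
    {ε : ℝ} {z : EuclideanSpace ℝ (Fin N) × ℝ} (hz : z ∈ parabolicStrip Ω T ε) :
    z.1 ∈ Metric.cthickening ε (closure Ω) ∧ z.2 ∈ Ioc (-(ε ^ 2 / 2)) T := by
  rcases hz with hz | hz
  · exact ⟨mem_cthickening_of_mem_spaceStrip hne hΩb hz.1, hz.2⟩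
  · exact ⟨Metric.self_subset_cthickening _ (subset_closure hz.1), hz.2.1, hz.2.2.trans hT.le⟩

/-- Data of a family of obstacle problems with a common modulus of continuity. -/
structure GameFamily (Ω : Set (EuclideanSpace ℝ (Fin N))) (T p : ℝ) (I : Set ℝ) (C : ℝ)
    (F ψ : EuclideanSpace ℝ (Fin N) × ℝ → ℝ) (u : ℝ → EuclideanSpace ℝ (Fin N) × ℝ → ℝ) :
    Prop where
  isOpen : IsOpen Ω
  nonempty : Ω.Nonempty
  isBounded : Bornology.IsBounded Ω
  time_pos : 0 < T
  two_le : 2 ≤ p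
  step_pos : ∀ ε ∈ I, 0 < ε
  modulus_nonneg : 0 ≤ C
  boundary_modulus : ∀ ε ∈ I, ∀ z ∈ parabolicStrip Ω T ε, ∀ w ∈ parabolicStrip Ω T ε,
    |F z - F w| ≤ C * (‖z.1 - w.1‖ + |z.2 - w.2| ^ (1 / 2 : ℝ))
  obstacle_modulus : ∀ z w, |ψ z - ψ w| ≤ C * (‖z.1 - w.1‖ + |z.2 - w.2| ^ (1 / 2 : ℝ))
  obstacle_le : ∀ ε ∈ I, ∀ z ∈ parabolicStrip Ω T ε, ψ z ≤ F z
  solution : ∀ ε ∈ I, IsDPPSolution Ω T p ε ψ F (u ε)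

variable {I : Set ℝ} {C : ℝ} {F ψ : EuclideanSpace ℝ (Fin N) × ℝ → ℝ}
  {u : ℝ → EuclideanSpace ℝ (Fin N) × ℝ → ℝ}

/-- Continuity up to the parabolic boundary of the solutions, uniformly for small step sizes,
at the point `b`. -/
def AttainsAt (Ω : Set (EuclideanSpace ℝ (Fin N))) (T : ℝ) (I : Set ℝ)
    (F : EuclideanSpace ℝ (Fin N) × ℝ → ℝ) (u : ℝ → EuclideanSpace ℝ (Fin N) × ℝ → ℝ)
    (b : EuclideanSpace ℝ (Fin N) × ℝ) : Prop :=
  ∀ η > 0, ∃ r > 0, ∃ ε₀ > 0, ∀ ε ∈ I, ε < ε₀ → ∀ z ∈ gameDomain Ω T ε, dist z b < r →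
    |u ε z - F b| < η

/-- The barrier is `2η/3 + K (φ y - φ x) + a t`. It is a supersolution when `K κ ε²` covers the
increase of `a` on going back by `ε²/2`. Both signs of `κ` occur: if positive, enlarge `K`; if
negative, make `a` steep. -/
theorem GameFamily.attainsAt_of_barrier (hG : GameFamily Ω T p I C F ψ u)
    {y : EuclideanSpace ℝ (Fin N)} {s : ℝ} (hb : ∀ ε ∈ I, (y, s) ∈ parabolicStrip Ω T ε)
    {φ : EuclideanSpace ℝ (Fin N) → ℝ} (hφ : Continuous φ)
    (hmax : ∀ x ∈ closure Ω, φ x ≤ φ y) (huniq : ∀ x ∈ closure Ω, φ x = φ y → x = y)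
    {κ ε₂ : ℝ} (hε₂ : 0 < ε₂)
    (hκ : ∀ ε, 0 < ε → ε < ε₂ → ∀ x ∈ Ω,
      φ x + κ * ε ^ 2 ≤ ballAverage p ε (fun h => φ (x + h)))
    (htime : ∀ η > 0, ∀ K₀ : ℝ, 0 ≤ K₀ → ∃ K ≥ K₀, ∃ a : ℝ → ℝ, Continuous a ∧ a s = 0 ∧
      ∃ ε₃ > 0, ∀ ε, 0 < ε → ε < ε₃ →
        (∀ t ∈ Ioc (-(ε ^ 2 / 2)) T, C * |t - s| ^ (1 / 2 : ℝ) ≤ η + a t) ∧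
        (∀ t ∈ Ioc 0 T, a (t - ε ^ 2 / 2) - a t ≤ K * κ * ε ^ 2)) :
    AttainsAt Ω T I F u (y, s) := by
  intro η hη
  obtain ⟨K₀, hK₀, hsep⟩ := exists_linear_le_of_unique_zero hG.isBounded.isCompact_closure
    (g := fun x => φ y - φ x) (by fun_prop) (fun x hx => sub_nonneg.2 (hmax x hx))
    (fun x hx h => huniq x hx (by linarith)) C (by positivity : 0 < η / 3)
  obtain ⟨K, hK, a, ha, has, ε₃, hε₃, hat⟩ := htime (η / 3) (by positivity) K₀ hK₀
  obtain ⟨ε₁, hε₁, hsep⟩ := hsep K hK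
  have hK0 : 0 ≤ K := hK₀.trans hK
  -- One `η/3` serves the spatial modulus and one the temporal modulus, leaving `W (y, s) = 2η/3 <
  -- η`.
  set W : EuclideanSpace ℝ (Fin N) × ℝ → ℝ := fun z =>
    (2 * (η / 3) + K * φ y + a z.2) + (-K) * φ z.1 with hWdef
  have hW : Continuous W := by fun_prop
  have hWb : W (y, s) < η := by
    simp only [hWdef, has]
    linarith
  obtain ⟨r, hr, hball⟩ := Metric.isOpen_iff.1 (isOpen_lt hW continuous_const) (y, s) hWb
  refine ⟨r, hr, min ε₁ (min ε₂ ε₃), by positivity, fun ε hε hεlt z hz hzr => ?_⟩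
  have hε0 := hG.step_pos ε hε
  obtain ⟨hlt1, hlt2, hlt3⟩ : ε < ε₁ ∧ ε < ε₂ ∧ ε < ε₃ := by simpa using hεlt
  obtain ⟨hat1, hat2⟩ := hat ε hε0 hlt3
  have hmod : ∀ x ∈ Metric.cthickening ε (closure Ω), ∀ t ∈ Ioc (-(ε ^ 2 / 2)) T,
      C * (‖x - y‖ + |t - s| ^ (1 / 2 : ℝ)) ≤ W (x, t) := by
    intro x hx t ht
    have h1 := hsep x (Metric.cthickening_mono hlt1.le _ hx)
    have h2 := hat1 t ht
    simp only [hWdef]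
    linarith
  have hε2 : 0 < ε ^ 2 := by positivity
  refine lt_of_le_of_lt ?_ (hball hzr : W z < η)
  refine (hG.solution ε hε).abs_sub_le_of_barrier hG.isOpen hG.two_le hε0 (W := W)
    (fun t => by fun_prop) (hG.obstacle_le ε hε _ (hb ε hε)) ?_ ?_ ?_ z hz
  · intro z hz
    obtain ⟨h1, h2⟩ := mem_of_mem_parabolicStrip hG.nonempty hG.isBounded hG.time_pos hz
    exact (hG.boundary_modulus ε hε z hz _ (hb ε hε)).trans (hmod _ h1 _ h2)
  · intro x hx t ht
    exact (hG.obstacle_modulus _ _).trans (hmod x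
      (Metric.self_subset_cthickening _ (subset_closure hx)) t ⟨by linarith [ht.1], ht.2⟩)
  · intro x hx t ht
    rw [gameAverage_eq_ballAverage]
    simp only [hWdef]
    rw [ballAverage_affine hG.two_le hε0 (f := fun h => φ (x + h))
      (Continuous.averageableOn (by fun_prop) ε)]
    have h1 := mul_le_mul_of_nonneg_left (hκ ε hε0 hlt2 x hx) hK0
    have h2 := hat2 t ht
    linarith

theorem gaussian_sub_eq (lam : ℝ) (c x h : EuclideanSpace ℝ (Fin N)) :
    gaussian lam (x + h - c) = gaussian lam (x - c + h) := by
  congr 1; abel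

theorem GameFamily.attainsAt_initial (hG : GameFamily Ω T p I C F ψ u)
    {y : EuclideanSpace ℝ (Fin N)} (hb : ∀ ε ∈ I, (y, 0) ∈ parabolicStrip Ω T ε) :
    AttainsAt Ω T I F u (y, 0) := by
  have hval : ∀ x, gaussian 1 (x - y) ≤ gaussian 1 (y - y) := by
    intro x
    simp only [gaussian, sub_self, norm_zero, one_mul]
    rw [Real.exp_le_exp]
    nlinarith [sq_nonneg ‖x - y‖]
  refine hG.attainsAt_of_barrier hb (φ := fun x => gaussian 1 (x - y)) (κ := -1) (ε₂ := 1 / 2)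
    ((continuous_gaussian 1).comp (by fun_prop)) (fun x _ => hval x) ?_ (by norm_num) ?_ ?_
  · intro x _ h
    simp only [gaussian, sub_self, norm_zero, one_mul, Real.exp_eq_exp] at h
    have : ‖x - y‖ = 0 := by nlinarith [norm_nonneg (x - y)]
    exact sub_eq_zero.1 (norm_eq_zero.1 this)
  · intro ε hε hlt x _
    have h1 := ballAverage_gaussian_ge hG.two_le zero_le_one hε (by nlinarith) (x - y)
    simp only [gaussian_sub_eq]
    refine le_trans ?_ h1
    have h2 : gaussian 1 (x - y) ≤ 1 := (hval x).trans (by simp [gaussian])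
    have h3 := gaussian_pos 1 (x - y)
    have h4 : 0 ≤ gaussian 1 (x - y) * ((1 : ℝ) ^ 2 * momentConstant N * ‖x - y‖ ^ 2 * ε ^ 2) := by
      have := momentConstant_pos (N := N)
      positivity
    nlinarith [mul_le_mul_of_nonneg_right h2 (sq_nonneg ε)]
  · intro η hη K₀ hK₀
    set m := C ^ 2 / (4 * (η / 2)) with hm
    have hm0 : 0 ≤ m := by positivity
    have hM : 0 ≤ m + 2 * K₀ := by positivity
    have hD : 0 < m + (m + 2 * K₀) + 1 := by positivity
    -- The part `m` of the slope dominates the time modulus; `2 K₀` over a time `ε²/2` repays the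
    -- Gaussian's loss `K₀ ε²`. The bound on `ε` lets `η/2` absorb the times `-ε²/2 < t < 0`.
    refine ⟨K₀, le_rfl, fun t => (m + 2 * K₀) * t, by fun_prop, by simp,
      min 1 (η / (m + (m + 2 * K₀) + 1)), by positivity, fun ε hε hlt => ⟨?_, ?_⟩⟩
    · intro t ht
      obtain ⟨hl1, hl2⟩ := lt_min_iff.1 hlt
      rw [lt_div_iff₀ hD] at hl2
      have h1 := mul_rpow_half_le C (t - 0) (by positivity : 0 < η / 2)
      rw [← hm] at h1
      refine h1.trans ?_
      rw [sub_zero]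
      rcases le_or_gt 0 t with h0 | h0
      · rw [abs_of_nonneg h0]
        nlinarith [mul_nonneg hK₀ h0]
      · rw [abs_of_neg h0]
        have h2 : -t ≤ ε / 2 := by nlinarith [ht.1]
        nlinarith [mul_le_mul_of_nonneg_left h2 (by positivity : 0 ≤ m + (m + 2 * K₀))]
    · intro t _
      nlinarith [mul_nonneg hm0 (sq_nonneg ε)]

/-- The exterior ball may touch `closure Ω` at several points. The ball of half the radius about the
midpoint of `z` and `y` touches it only at `y`, so a Gaussian centred there has `y` as its unique
maximum point. -/
theorem GameFamily.attainsAt_lateral (hG : GameFamily Ω T p I C F ψ u)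
    (hΩs : ExteriorSphereCondition Ω) {y : EuclideanSpace ℝ (Fin N)} (hy : y ∈ frontier Ω)
    {s : ℝ} (hb : ∀ ε ∈ I, (y, s) ∈ parabolicStrip Ω T ε) :
    AttainsAt Ω T I F u (y, s) := by
  obtain ⟨z, δ, hδ, hsub, hyz⟩ := hΩs y hy
  have hyδ : ‖y - z‖ = δ := by
    rw [← mem_sphere_iff_norm]
    exact Metric.frontier_ball_subset_sphere hyz
  set c : EuclideanSpace ℝ (Fin N) := z + (1 / 2 : ℝ) • (y - z) with hc
  have hcz : ‖c - z‖ = δ / 2 := by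
    rw [hc, add_sub_cancel_left, norm_smul, hyδ]
    norm_num
    ring
  have hyc' : y - c = c - z := by
    rw [hc]
    module
  have hyc : ‖y - c‖ = δ / 2 := by rw [hyc', hcz]
  have hfar : ∀ x ∈ closure Ω, δ ≤ ‖x - z‖ := by
    have : Ω ⊆ {x | δ ≤ ‖x - z‖} := by
      intro x hx
      by_contra hcon
      exact hsub (mem_ball_iff_norm.2 (not_le.1 hcon)) hx
    exact fun x hx => closure_minimal this (isClosed_le continuous_const (by fun_prop)) hx
  have hnear : ∀ x ∈ closure Ω, δ / 2 ≤ ‖x - c‖ := by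
    intro x hx
    have h1 : ‖x - z‖ ≤ ‖x - c‖ + ‖c - z‖ := norm_sub_le_norm_sub_add_norm_sub x c z
    linarith [hfar x hx]
  have huniq : ∀ x ∈ closure Ω, ‖x - c‖ = δ / 2 → x = y := by
    intro x hx hxc
    have h1 := parallelogram_law_with_norm ℝ (x - c) (c - z)
    have h2 : x - c + (c - z) = x - z := by abel
    have h3 : x - c - (c - z) = x - y := by rw [← hyc']; abel
    rw [h2, h3, hxc, hcz] at h1
    have h4 : ‖x - y‖ = 0 := by nlinarith [hfar x hx, norm_nonneg (x - y), norm_nonneg (x - z)]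
    exact sub_eq_zero.1 (norm_eq_zero.1 h4)
  have hm := momentConstant_pos (N := N)
  -- At distance at least `δ/2` from `c` the second-moment gain is then at least `2 lam ε²`, twice
  -- the loss `lam ε²`.
  set lam : ℝ := 2 / (momentConstant N * (δ / 2) ^ 2) with hlam
  have hlam0 : 0 < lam := by positivity
  have hlameq : lam * (momentConstant N * (δ / 2) ^ 2) = 2 := by
    rw [hlam]
    field_simp
  have hcont : Continuous fun x : EuclideanSpace ℝ (Fin N) => gaussian lam (x - c) :=
    (continuous_gaussian lam).comp (by fun_prop)
  obtain ⟨x₁, hx₁, hmin⟩ := hG.isBounded.isCompact_closure.exists_isMinOn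
    hG.nonempty.closure hcont.continuousOn
  set κ := lam * gaussian lam (x₁ - c) with hκ
  have hκ0 : 0 < κ := mul_pos hlam0 (gaussian_pos _ _)
  refine hG.attainsAt_of_barrier hb (φ := fun x => gaussian lam (x - c)) (κ := κ)
    (ε₂ := min 1 (1 / (2 * lam))) hcont ?_ ?_ (by positivity) ?_ ?_
  · intro x hx
    simp only [gaussian, hyc]
    gcongr
    exact hnear x hx
  · intro x hx h
    simp only [gaussian, Real.exp_eq_exp, neg_inj, mul_right_inj' hlam0.ne'] at h
    refine huniq x hx ?_
    rw [← hyc]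
    exact (pow_left_inj₀ (norm_nonneg _) (norm_nonneg _) two_ne_zero).1 h
  · intro ε hε hlt x hx
    obtain ⟨hl1, hl2⟩ := lt_min_iff.1 hlt
    rw [lt_div_iff₀ (by positivity)] at hl2
    have hle : lam * ε ^ 2 ≤ 1 / 2 := by nlinarith [mul_pos hlam0 hε]
    have h1 := ballAverage_gaussian_ge hG.two_le hlam0.le hε hle (x - c)
    simp only [gaussian_sub_eq]
    refine le_trans ?_ h1
    have h2 : gaussian lam (x₁ - c) ≤ gaussian lam (x - c) := hmin (subset_closure hx)
    have h3 := gaussian_pos lam (x - c)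
    have h4 : 2 ≤ lam * momentConstant N * ‖x - c‖ ^ 2 := by
      rw [← hlameq, mul_assoc]
      have := hnear x (subset_closure hx)
      gcongr
    have h5 : lam * ε ^ 2 ≤
        - (lam * ε ^ 2) + lam ^ 2 * momentConstant N * ‖x - c‖ ^ 2 * ε ^ 2 := by
      nlinarith [mul_le_mul_of_nonneg_left h4 (by positivity : 0 ≤ lam * ε ^ 2)]
    calc gaussian lam (x - c) + κ * ε ^ 2
        ≤ gaussian lam (x - c) * (1 + lam * ε ^ 2) := by
          rw [hκ]
          nlinarith [mul_le_mul_of_nonneg_right h2 (by positivity : 0 ≤ lam * ε ^ 2)]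
      _ ≤ _ := mul_le_mul_of_nonneg_left (by linarith) h3.le
  · intro η hη K₀ hK₀
    set m := C ^ 2 / (4 * η) with hm
    have hm0 : 0 ≤ m := by positivity
    -- `K ≥ m / κ` makes the spatial gain cover the time variation of `m |t - s|`.
    refine ⟨max K₀ (m / κ), le_max_left _ _, fun t => m * |t - s|, by fun_prop, by simp, 1,
      one_pos, fun ε hε _ => ⟨fun t _ => mul_rpow_half_le C (t - s) hη, fun t _ => ?_⟩⟩
    have h1 : m ≤ max K₀ (m / κ) * κ := (div_le_iff₀ hκ0).1 (le_max_right _ _)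
    have h2 : |t - ε ^ 2 / 2 - s| - |t - s| ≤ ε ^ 2 := by
      have h3 := abs_sub_abs_le_abs_sub (t - ε ^ 2 / 2 - s) (t - s)
      rw [show t - ε ^ 2 / 2 - s - (t - s) = -(ε ^ 2 / 2) by ring, abs_neg,
        abs_of_nonneg (by positivity : 0 ≤ ε ^ 2 / 2)] at h3
      nlinarith [sq_nonneg ε]
    calc m * |t - ε ^ 2 / 2 - s| - m * |t - s| = m * (|t - ε ^ 2 / 2 - s| - |t - s|) := by ring
      _ ≤ m * ε ^ 2 := by gcongr
      _ ≤ _ := by gcongr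

end Boundary

/-! ### Asymptotic equicontinuity by translation -/

section Equicontinuity

variable {N : ℕ} {Ω : Set (EuclideanSpace ℝ (Fin N))} {T p : ℝ}
  {I : Set ℝ} {C : ℝ} {F ψ : EuclideanSpace ℝ (Fin N) × ℝ → ℝ}
  {u : ℝ → EuclideanSpace ℝ (Fin N) × ℝ → ℝ}

/-- The parabolic boundary of the cylinder. -/
def parabolicBoundary (Ω : Set (EuclideanSpace ℝ (Fin N))) (T : ℝ) :
    Set (EuclideanSpace ℝ (Fin N) × ℝ) :=
  (frontier Ω ×ˢ Icc 0 T) ∪ (closure Ω ×ˢ {0})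

theorem isCompact_parabolicBoundary (hΩb : Bornology.IsBounded Ω) :
    IsCompact (parabolicBoundary Ω T) :=
  ((hΩb.isCompact_closure.of_isClosed_subset isClosed_frontier frontier_subset_closure).prod
    isCompact_Icc).union (hΩb.isCompact_closure.prod isCompact_singleton)

theorem closure_cylinder (hT : 0 < T) : closure (cylinder Ω T) = closure Ω ×ˢ Icc 0 T := by
  rw [cylinder, closure_prod_eq, closure_Ioo hT.ne]

theorem frontier_prod_subset_parabolicStrip (hΩ : IsOpen Ω) {ε : ℝ} (hε : 0 < ε) :
    frontier Ω ×ˢ Icc 0 T ⊆ parabolicStrip Ω T ε := by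
  rintro ⟨x, t⟩ ⟨hx, ht⟩
  have hε2 : 0 < ε ^ 2 := by positivity
  rw [hΩ.frontier_eq] at hx
  refine Or.inl ⟨⟨hx.2, ?_⟩, by linarith [ht.1], ht.2⟩
  rw [Metric.infDist_zero_of_mem (by rw [hΩ.frontier_eq]; exact hx)]
  exact hε.le

theorem parabolicBoundary_subset_parabolicStrip (hΩ : IsOpen Ω) (hT : 0 < T) {ε : ℝ}
    (hε : 0 < ε) : parabolicBoundary Ω T ⊆ parabolicStrip Ω T ε := by
  have hε2 : 0 < ε ^ 2 := by positivity
  rintro ⟨x, t⟩ (hz | ⟨hx, ht⟩)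
  · exact frontier_prod_subset_parabolicStrip hΩ hε hz
  · obtain rfl : t = 0 := ht
    by_cases hxΩ : x ∈ Ω
    · exact Or.inr ⟨hxΩ, by dsimp only; linarith, le_rfl⟩
    · refine frontier_prod_subset_parabolicStrip hΩ hε ⟨?_, le_rfl, hT.le⟩
      rw [hΩ.frontier_eq]
      exact ⟨hx, hxΩ⟩

theorem closure_cylinder_subset_gameDomain (hΩ : IsOpen Ω) (hT : 0 < T) {ε : ℝ} (hε : 0 < ε) :
    closure (cylinder Ω T) ⊆ gameDomain Ω T ε := by
  rw [closure_cylinder hT]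
  rintro ⟨x, t⟩ ⟨hx, ht⟩
  by_cases hxΩ : x ∈ Ω
  · rcases ht.1.eq_or_lt with h0 | h0
    · exact Or.inr (parabolicBoundary_subset_parabolicStrip hΩ hT hε (Or.inr ⟨hx, h0.symm⟩))
    · exact Or.inl ⟨hxΩ, h0, ht.2⟩
  · refine Or.inr (frontier_prod_subset_parabolicStrip hΩ hε ⟨?_, ht⟩)
    rw [hΩ.frontier_eq]
    exact ⟨hx, hxΩ⟩

theorem GameFamily.attainsAt_parabolicBoundary (hG : GameFamily Ω T p I C F ψ u)
    (hΩs : ExteriorSphereCondition Ω) {b : EuclideanSpace ℝ (Fin N) × ℝ}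
    (hb : b ∈ parabolicBoundary Ω T) : AttainsAt Ω T I F u b := by
  have hstrip : ∀ ε ∈ I, b ∈ parabolicStrip Ω T ε := fun ε hε =>
    parabolicBoundary_subset_parabolicStrip hG.isOpen hG.time_pos (hG.step_pos ε hε) hb
  obtain ⟨x, t⟩ := b
  rcases hb with ⟨hx, -⟩ | ⟨-, ht⟩
  · exact hG.attainsAt_lateral hΩs hx hstrip
  · obtain rfl : t = 0 := ht
    exact hG.attainsAt_initial hstrip

theorem GameFamily.exists_modulus_near_parabolicBoundary (hG : GameFamily Ω T p I C F ψ u)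
    (hΩs : ExteriorSphereCondition Ω) {η : ℝ} (hη : 0 < η) :
    ∃ ρ > 0, ∃ ε₀ > 0, ∀ ε ∈ I, ε < ε₀ → ∀ z ∈ gameDomain Ω T ε, ∀ w ∈ gameDomain Ω T ε,
      dist z w < ρ → ∀ b ∈ parabolicBoundary Ω T, dist z b < ρ → |u ε z - u ε w| < η := by
  refine (isCompact_parabolicBoundary (T := T) hG.isBounded).induction_on
    (p := fun S => ∃ ρ > 0, ∃ ε₀ > 0, ∀ ε ∈ I, ε < ε₀ → ∀ z ∈ gameDomain Ω T ε,
      ∀ w ∈ gameDomain Ω T ε, dist z w < ρ → ∀ b ∈ S, dist z b < ρ → |u ε z - u ε w| < η)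
    ?_ ?_ ?_ ?_
  · exact ⟨1, one_pos, 1, one_pos, fun _ _ _ _ _ _ _ _ b hb => hb.elim⟩
  · rintro S S' hSS ⟨ρ, hρ, ε₀, hε₀, h⟩
    exact ⟨ρ, hρ, ε₀, hε₀, fun ε hε hlt z hz w hw hd b hb => h ε hε hlt z hz w hw hd b (hSS hb)⟩
  · rintro S S' ⟨ρ, hρ, ε₀, hε₀, h⟩ ⟨ρ', hρ', ε₀', hε₀', h'⟩
    refine ⟨min ρ ρ', by positivity, min ε₀ ε₀', by positivity, ?_⟩
    rintro ε hε hlt z hz w hw hd b (hb | hb) hzb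
    · exact h ε hε (hlt.trans_le (min_le_left _ _)) z hz w hw (hd.trans_le (min_le_left _ _)) b hb
        (hzb.trans_le (min_le_left _ _))
    · exact h' ε hε (hlt.trans_le (min_le_right _ _)) z hz w hw
        (hd.trans_le (min_le_right _ _)) b hb (hzb.trans_le (min_le_right _ _))
  · intro b hb
    obtain ⟨r, hr, ε₀, hε₀, h⟩ := hG.attainsAt_parabolicBoundary hΩs hb (η / 2) (by positivity)
    -- Three legs, `w` to `z` to `b'` to `b`, must stay within `r`.
    refine ⟨Metric.ball b (r / 3), mem_nhdsWithin_of_mem_nhds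
      (Metric.ball_mem_nhds b (by positivity)), r / 3, by positivity, ε₀, hε₀, ?_⟩
    intro ε hε hlt z hz w hw hzw b' hb' hzb'
    have hb'b : dist b' b < r / 3 := hb'
    have h1 : dist z b < r := by linarith [dist_triangle z b' b]
    have h2 : dist w b < r := by
      linarith [dist_triangle w z b, dist_triangle z b' b, dist_comm w z]
    have h3 := abs_lt.1 (h ε hε hlt z hz h1)
    have h4 := abs_lt.1 (h ε hε hlt w hw h2)
    rw [abs_lt]
    constructor <;> linarith [h3.1, h3.2, h4.1, h4.2]

/-- Testing against `(f, t)` with `f` on the frontier isolates the spatial distance; testing against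
`(x, 0)` isolates the time. -/
theorem ball_subset_of_far {z : EuclideanSpace ℝ (Fin N) × ℝ} (hΩ : IsOpen Ω)
    {ρ : ℝ} (hz : z ∈ closure Ω ×ˢ Icc 0 T) (hρ : 0 < ρ)
    (hfar : ∀ b ∈ parabolicBoundary Ω T, ρ ≤ dist z b) :
    Metric.ball z.1 ρ ⊆ Ω ∧ ρ ≤ z.2 := by
  obtain ⟨x, t⟩ := z
  obtain ⟨hx, ht⟩ := hz
  have hfr : ∀ f ∈ frontier Ω, ρ ≤ dist x f := by
    intro f hf
    simpa [Prod.dist_eq] using hfar (f, t) (Or.inl ⟨hf, ht⟩)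
  have hxΩ : x ∈ Ω := by
    by_contra hcon
    have := hfr x (by rw [hΩ.frontier_eq]; exact ⟨hx, hcon⟩)
    rw [dist_self] at this
    linarith
  constructor
  · intro y hy
    by_contra hcon
    obtain ⟨f, hf, hd, -⟩ := exists_mem_frontier_of_mem_of_notMem hΩ hxΩ hcon
    rw [Metric.mem_ball, dist_comm] at hy
    rw [dist_comm] at hd
    linarith [hfr f hf]
  · have := hfar (x, 0) (Or.inr ⟨hx, rfl⟩)
    simpa [Prod.dist_eq, abs_of_nonneg ht.1, hρ.not_ge] using this

theorem abs_max_sub_max_le_of_le {a b c d η : ℝ} (h1 : |a - c| ≤ η) (h2 : |b - d| ≤ η) :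
    |max a b - max c d| ≤ η :=
  (abs_max_sub_max_le_max a b c d).trans (max_le h1 h2)

theorem GameFamily.exists_modulus (hG : GameFamily Ω T p I C F ψ u)
    (hΩs : ExteriorSphereCondition Ω) {η : ℝ} (hη : 0 < η) :
    ∃ r₀ > 0, ∃ ε₀ > 0, ∀ ε ∈ I, ε < ε₀ → ∀ z ∈ closure (cylinder Ω T),
      ∀ w ∈ closure (cylinder Ω T), ‖z.1 - w.1‖ + |z.2 - w.2| < r₀ → |u ε z - u ε w| < η := by
  obtain ⟨ρ, hρ, ε₀, hε₀, hnear⟩ := hG.exists_modulus_near_parabolicBoundary hΩs (half_pos hη)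
  have hmodcont : Continuous fun r : ℝ => C * (r + r ^ (1 / 2 : ℝ)) := by
    have := Real.continuous_rpow_const (q := (1 / 2 : ℝ)) (by norm_num)
    fun_prop
  obtain ⟨r₁, hr₁, hmod⟩ : ∃ r₁ > 0, ∀ r : ℝ, 0 ≤ r → r < r₁ →
      C * (r + r ^ (1 / 2 : ℝ)) < η / 2 := by
    obtain ⟨r₁, hr₁, h⟩ := Metric.isOpen_iff.1
      (isOpen_lt hmodcont (continuous_const (y := η / 2))) 0
      (by simp only [mem_ofPred_eq]; rw [Real.zero_rpow (by norm_num)]; simpa using hη)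
    exact ⟨r₁, hr₁, fun r hr0 hr => h (by simpa [abs_of_nonneg hr0] using hr)⟩
  refine ⟨min ρ r₁, by positivity, min ε₀ (min 1 ρ), by positivity, ?_⟩
  intro ε hε hlt z hz w hw hzw
  have hε0 := hG.step_pos ε hε
  obtain ⟨hl1, hl2, hl3⟩ : ε < ε₀ ∧ ε < 1 ∧ ε < ρ := by simpa using hlt
  obtain ⟨hd1, hd2⟩ := lt_min_iff.1 hzw
  have hε2 : 0 < ε ^ 2 / 2 := by positivity
  have hερ : ε ^ 2 / 2 < ρ := by nlinarith
  rw [closure_cylinder hG.time_pos] at hz hw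
  have hdom : closure Ω ×ˢ Icc 0 T ⊆ gameDomain Ω T ε := by
    rw [← closure_cylinder hG.time_pos]
    exact closure_cylinder_subset_gameDomain hG.isOpen hG.time_pos hε0
  obtain ⟨g, hgdef⟩ : ∃ g, g = w - z := ⟨_, rfl⟩
  have hg : ‖g.1‖ + |g.2| < min ρ r₁ := by
    rw [hgdef, Prod.fst_sub, Prod.snd_sub, norm_sub_rev, abs_sub_comm]
    exact hzw
  obtain ⟨hgρ, hgr⟩ := lt_min_iff.1 hg
  have hdist : ∀ z', dist z' (z' + g) < ρ := by
    intro z'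
    rw [dist_self_add_right, Prod.norm_def, Real.norm_eq_abs]
    exact max_lt (by linarith [abs_nonneg g.2]) (by linarith [norm_nonneg g.1])
  have hψg : ∀ z', |ψ z' - ψ (z' + g)| ≤ η / 2 := by
    intro z'
    refine (hG.obstacle_modulus z' (z' + g)).trans (le_trans ?_ (hmod _ (by positivity) hgr).le)
    rw [Prod.fst_add, Prod.snd_add, sub_add_cancel_left, sub_add_cancel_left, norm_neg, abs_neg]
    have hC := hG.modulus_nonneg
    gcongr
    · linarith [abs_nonneg g.2]
    · linarith [norm_nonneg g.1]
  -- The shift `g` stays fixed while `z'` varies, and the bound `η / 2` is the same at every level: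
  -- no error accumulates.
  have key : ∀ n : ℕ, ∀ z', z' ∈ closure Ω ×ˢ Icc 0 T → z' + g ∈ closure Ω ×ˢ Icc 0 T →
      z'.2 ≤ n * (ε ^ 2 / 2) → |u ε z' - u ε (z' + g)| ≤ η / 2 := by
    intro n
    induction n with
    | zero =>
      intro z' hz' hzg hn
      have h0 : z'.2 = 0 := le_antisymm (by simpa using hn) hz'.2.1
      exact (hnear ε hε hl1 z' (hdom hz') _ (hdom hzg) (hdist z') z' (Or.inr ⟨hz'.1, h0⟩)
        (by simpa using hρ)).le
    | succ n ih =>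
      intro z' hz' hzg hn
      by_cases hb : ∃ b ∈ parabolicBoundary Ω T, dist z' b < ρ
      · obtain ⟨b, hb, hd⟩ := hb
        exact (hnear ε hε hl1 z' (hdom hz') _ (hdom hzg) (hdist z') b hb hd).le
      by_cases hb' : ∃ b ∈ parabolicBoundary Ω T, dist (z' + g) b < ρ
      · obtain ⟨b, hb', hd⟩ := hb'
        rw [abs_sub_comm]
        exact (hnear ε hε hl1 _ (hdom hzg) z' (hdom hz') (by rw [dist_comm]; exact hdist z') b hb'
          hd).le
      push Not at hb hb'
      obtain ⟨hball, htρ⟩ := ball_subset_of_far hG.isOpen hz' hρ hb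
      obtain ⟨hball', htρ'⟩ := ball_subset_of_far hG.isOpen hzg hρ hb'
      have hsol := hG.solution ε hε
      have hx : z'.1 ∈ Ω := hball (Metric.mem_ball_self hρ)
      have hx' : (z' + g).1 ∈ Ω := hball' (Metric.mem_ball_self hρ)
      have ht : z'.2 ∈ Ioc 0 T := ⟨hρ.trans_le htρ, hz'.2.2⟩
      have ht' : (z' + g).2 ∈ Ioc 0 T := ⟨hρ.trans_le htρ', hzg.2.2⟩
      have e1 := hsol.dpp z'.1 hx z'.2 ht
      have e2 := hsol.dpp (z' + g).1 hx' (z' + g).2 ht'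
      rw [Prod.mk.eta] at e1 e2
      rw [e1, e2]
      refine abs_max_sub_max_le_of_le (hψg z') ?_
      rw [gameAverage_eq_ballAverage, gameAverage_eq_ballAverage]
      refine ballAverage_sub_le hG.two_le hε0 (hsol.averageableOn hG.isOpen hε0 hx ht)
        (hsol.averageableOn hG.isOpen hε0 hx' ht') fun h hh => ?_
      -- A step moves less than `ρ` in space and in time, so from both points it stays in the closed
      -- cylinder.
      have hh' : ‖h‖ < ρ := (mem_ball_zero_iff.1 hh).trans hl3
      have e3 : ((z' + g).1 + h, (z' + g).2 - ε ^ 2 / 2) =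
          (z'.1 + h, z'.2 - ε ^ 2 / 2) + g := by
        ext1
        · simp only [Prod.fst_add]; abel
        · simp only [Prod.snd_add]; ring
      rw [e3]
      refine ih _ ⟨subset_closure (hball ?_), ?_, ?_⟩ ?_ ?_
      · simpa using hh'
      · dsimp only; linarith
      · dsimp only; linarith [ht.2]
      · rw [← e3]
        refine ⟨subset_closure (hball' ?_), ?_, ?_⟩
        · simpa using hh'
        · dsimp only; linarith
        · dsimp only; linarith [ht'.2]
      · push_cast at hn
        dsimp only
        linarith
  obtain ⟨n, hn⟩ := exists_nat_ge (z.2 / (ε ^ 2 / 2))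
  have hzg : z + g = w := by rw [hgdef]; abel
  have := key n z hz (by rwa [hzg]) ((div_le_iff₀ hε2).1 hn)
  rw [hzg] at this
  linarith

end Equicontinuity

/-! ### Arzelà–Ascoli for asymptotically equicontinuous sequences -/

section Compactness

variable {X : Type*} [PseudoMetricSpace X]

/-- An Arzelà–Ascoli theorem for sequences of possibly discontinuous functions that are uniformly
bounded and asymptotically uniformly equicontinuous. -/
theorem exists_subseq_tendstoUniformlyOn {S : Set X} (hS : IsCompact S) {f : ℕ → X → ℝ} {M : ℝ}
    (hM : ∀ j, ∀ x ∈ S, |f j x| ≤ M)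
    (heq : ∀ η > 0, ∃ r > 0, ∃ J : ℕ, ∀ j ≥ J, ∀ x ∈ S, ∀ y ∈ S, dist x y < r →
      |f j x - f j y| < η) :
    ∃ φ : ℕ → ℕ, StrictMono φ ∧ ∃ v : X → ℝ, UniformContinuousOn v S ∧
      TendstoUniformlyOn (fun j => f (φ j)) v Filter.atTop S := by
  obtain ⟨D, hDS, hDc, hD⟩ := hS.isSeparable.exists_countable_dense_subset
  have : Countable D := hDc.to_subtype
  -- Sequential compactness of this countable product replaces the diagonal argument.
  have hcomp : IsCompact (univ.pi fun _ : D => Icc (-M) M) :=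
    isCompact_univ_pi fun _ => isCompact_Icc
  obtain ⟨l, -, φ, hφ, hl⟩ := hcomp.isSeqCompact (x := fun j (d : D) => f j d)
    (fun j d _ => abs_le.1 (hM j d (hDS d.2)))
  obtain ⟨L, hL⟩ : ∃ L : X → ℝ, ∀ d ∈ D,
      Filter.Tendsto (fun j => f (φ j) d) Filter.atTop (nhds (L d)) := by
    classical
    refine ⟨fun d => if h : d ∈ D then l ⟨d, h⟩ else 0, fun d hd => ?_⟩
    simp only [dif_pos hd]
    exact (tendsto_pi_nhds.1 hl) ⟨d, hd⟩
  have hcauchy : UniformCauchySeqOn (fun j => f (φ j)) Filter.atTop S := by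
    rw [Metric.uniformCauchySeqOn_iff]
    intro η hη
    obtain ⟨r, hr, J, hJ⟩ := heq (η / 4) (by positivity)
    obtain ⟨t, htD, ht⟩ := hS.elim_finite_subcover_image (b := D)
      (c := fun d => Metric.ball d r) (fun d _ => Metric.isOpen_ball) (fun x hx => by
        obtain ⟨d, hd, hxd⟩ := Metric.mem_closure_iff.1 (hD hx) r hr
        exact mem_iUnion₂.2 ⟨d, hd, hxd⟩)
    obtain ⟨htfin, hcover⟩ := ht
    have hpt : ∀ᶠ j in Filter.atTop, ∀ d ∈ t, |f (φ j) d - L d| < η / 8 := by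
      rw [Filter.eventually_all_finite htfin]
      intro d hd
      simpa [Real.dist_eq] using Metric.tendsto_nhds.1 (hL d (htD hd)) (η / 8) (by positivity)
    obtain ⟨J', hJ'⟩ := Filter.eventually_atTop.1 hpt
    refine ⟨max J J', fun m hm n hn x hx => ?_⟩
    obtain ⟨d, hd, hxd⟩ := mem_iUnion₂.1 (hcover hx)
    have hdS := hDS (htD hd)
    -- Two errors `η/4` from equicontinuity and two `η/8` from convergence at `d` total `3η/4`.
    have h1 := abs_lt.1 (hJ (φ m) (((le_max_left _ _).trans hm).trans (hφ.id_le m)) x hx d hdS hxd)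
    have h2 := abs_lt.1 (hJ (φ n) (((le_max_left _ _).trans hn).trans (hφ.id_le n)) x hx d hdS hxd)
    have h3 := abs_lt.1 (hJ' m ((le_max_right _ _).trans hm) d hd)
    have h4 := abs_lt.1 (hJ' n ((le_max_right _ _).trans hn) d hd)
    rw [Real.dist_eq, abs_lt]
    constructor <;> linarith [h1.1, h1.2, h2.1, h2.2, h3.1, h3.2, h4.1, h4.2]
  have hlim : ∀ x, ∃ c, x ∈ S → Filter.Tendsto (fun j => f (φ j) x) Filter.atTop (nhds c) := by
    intro x
    by_cases hx : x ∈ S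
    · obtain ⟨c, hc⟩ := cauchySeq_tendsto_of_complete (hcauchy.cauchySeq hx)
      exact ⟨c, fun _ => hc⟩
    · exact ⟨0, fun h => absurd h hx⟩
  choose v hv using hlim
  have hunif := hcauchy.tendstoUniformlyOn_of_tendsto hv
  refine ⟨φ, hφ, v, ?_, hunif⟩
  rw [Metric.uniformContinuousOn_iff]
  intro η hη
  obtain ⟨r, hr, J, hJ⟩ := heq (η / 2) (by positivity)
  refine ⟨r, hr, fun x hx y hy hxy => ?_⟩
  have hle : |v x - v y| ≤ η / 2 := by
    refine le_of_tendsto ((hv x hx).sub (hv y hy)).abs ?_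
    filter_upwards [Filter.eventually_ge_atTop J] with j hj
    exact (hJ (φ j) (hj.trans (hφ.id_le j)) x hx y hy hxy).le
  rw [Real.dist_eq]
  linarith

end Compactness

end TugOfWar

/-! ### Assembly of the three claims -/

theorem lemma4p5 {N : ℕ} (hN : 1 ≤ N)
    (Ω : Set (EuclideanSpace ℝ (Fin N))) (hΩo : IsOpen Ω) (hΩc : IsConnected Ω)
    (hΩb : Bornology.IsBounded Ω) (hΩs : TugOfWar.ExteriorSphereCondition Ω)
    (T : ℝ) (hT : 0 < T) (p : ℝ) (hp : 2 ≤ p)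
    -- the admissible step sizes, for instance all of `(0, ∞)` or `(0, ε₁)`
    (I : Set ℝ) (hIpos : ∀ ε ∈ I, 0 < ε) (hIzero : (0 : ℝ) ∈ closure I)
    (F ψ : EuclideanSpace ℝ (Fin N) × ℝ → ℝ)
    (hFb : ∃ M : ℝ, ∀ ε ∈ I, ∀ z ∈ TugOfWar.parabolicStrip Ω T ε, |F z| ≤ M)
    (hψb : ∃ M : ℝ, ∀ z, |ψ z| ≤ M)
    (C₁ C₂ : ℝ)
    (hF : ∀ ε ∈ I, ∀ z ∈ TugOfWar.parabolicStrip Ω T ε,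
      ∀ w ∈ TugOfWar.parabolicStrip Ω T ε,
        |F z - F w| ≤ C₁ * (‖z.1 - w.1‖ + |z.2 - w.2| ^ (1 / 2 : ℝ)))
    (hψ : ∀ z w, |ψ z - ψ w| ≤ C₂ * (‖z.1 - w.1‖ + |z.2 - w.2| ^ (1 / 2 : ℝ)))
    (hψF : ∀ ε ∈ I, ∀ z ∈ TugOfWar.parabolicStrip Ω T ε, ψ z ≤ F z)
    (u : ℝ → EuclideanSpace ℝ (Fin N) × ℝ → ℝ)
    (hu : ∀ ε ∈ I, TugOfWar.IsDPPSolution Ω T p ε ψ F (u ε)) :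
    (∃ C : ℝ, 0 < C ∧ ∀ ε ∈ I, ∀ z ∈ closure (TugOfWar.cylinder Ω T), |u ε z| < C) ∧
    (∀ η : ℝ, 0 < η → ∃ r₀ : ℝ, 0 < r₀ ∧ ∃ ε₀ : ℝ, 0 < ε₀ ∧
      ∀ ε ∈ I, ε < ε₀ →
        ∀ z ∈ closure (TugOfWar.cylinder Ω T), ∀ w ∈ closure (TugOfWar.cylinder Ω T),
          ‖z.1 - w.1‖ + |z.2 - w.2| < r₀ → |u ε z - u ε w| < η) ∧
    (∀ e : ℕ → ℝ, (∀ j, e j ∈ I) → Filter.Tendsto e Filter.atTop (nhds 0) →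
      ∃ φ : ℕ → ℕ, StrictMono φ ∧ ∃ v : EuclideanSpace ℝ (Fin N) × ℝ → ℝ,
        UniformContinuousOn v (closure (TugOfWar.cylinder Ω T)) ∧
        TendstoUniformlyOn (fun j => u (e (φ j))) v Filter.atTop
          (closure (TugOfWar.cylinder Ω T))) := by
  have hfam : TugOfWar.GameFamily Ω T p I (max (max C₁ C₂) 0) F ψ u :=
    { isOpen := hΩo
      nonempty := hΩc.nonempty
      isBounded := hΩb
      time_pos := hT
      two_le := hp
      step_pos := hIpos
      modulus_nonneg := le_max_right _ _
      boundary_modulus := fun ε hε z hz w hw => (hF ε hε z hz w hw).trans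
        (mul_le_mul_of_nonneg_right ((le_max_left _ _).trans (le_max_left _ _)) (by positivity))
      obstacle_modulus := fun z w => (hψ z w).trans
        (mul_le_mul_of_nonneg_right ((le_max_right _ _).trans (le_max_left _ _)) (by positivity))
      obstacle_le := hψF
      solution := hu }
  obtain ⟨M₁, hM₁⟩ := hFb
  obtain ⟨M₂, hM₂⟩ := hψb
  have hbound : ∀ ε ∈ I, ∀ z ∈ closure (TugOfWar.cylinder Ω T), |u ε z| ≤ max M₁ M₂ :=
    fun ε hε z hz => (hu ε hε).abs_le_bound hΩo hp (hIpos ε hε)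
      (fun z hz => (hM₁ ε hε z hz).trans (le_max_left _ _))
      (fun z => (hM₂ z).trans (le_max_right _ _)) z
      (TugOfWar.closure_cylinder_subset_gameDomain hΩo hT (hIpos ε hε) hz)
  refine ⟨⟨max (max M₁ M₂) 0 + 1, by positivity, fun ε hε z hz => ?_⟩,
    fun η hη => hfam.exists_modulus hΩs hη, fun e heI he => ?_⟩
  · linarith [hbound ε hε z hz, le_max_left (max M₁ M₂) 0]
  · have hcomp : IsCompact (closure (TugOfWar.cylinder Ω T)) := by
      rw [TugOfWar.closure_cylinder hT]
      exact hΩb.isCompact_closure.prod isCompact_Icc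
    refine TugOfWar.exists_subseq_tendstoUniformlyOn hcomp (f := fun j => u (e j))
      (fun j => hbound (e j) (heI j)) fun η hη => ?_
    obtain ⟨r₀, hr₀, ε₀, hε₀, h⟩ := hfam.exists_modulus hΩs hη
    obtain ⟨J, hJ⟩ := Filter.eventually_atTop.1 (he.eventually_lt_const hε₀)
    -- The product carries the maximum metric while the modulus uses the sum of both distances.
    refine ⟨r₀ / 2, by positivity, J, fun j hj x hx y hy hxy =>
      h (e j) (heI j) (hJ j hj) x hx y hy ?_⟩
    rw [Prod.dist_eq, max_lt_iff, dist_eq_norm, Real.dist_eq] at hxy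
    linarith [hxy.1, hxy.2]
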